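/- Let $\mathsf{Smooth}$ be the category of finite-dimensional smooth manifolds (Hausdorff, second countable, without boundary) and smooth maps, let $\mathrm T\colon\mathsf{Smooth}\to\mathsf{Smooth}$ be the tangent bundle functor, $\mathrm T^n$ its $n$-th iterate, and $p\colon\mathrm T\Rightarrow\mathrm{id}$ the natural transformation given by the tangent bundle projections. A *tangent pullback* is a pullback square which is sent to a pullback square by $\mathrm T^n$ for every $n\ge 1$. A *weak pullback* is a commutative square satisfying the existence, but not necessarily the uniqueness, part of the universal property of a pullback; a *weak tangent pullback* is a weak pullback square which is sent to a weak pullback square by $\mathrm T^n$ for every $n\ge1$. A smooth map $q\colon E\to M$ *admits all tangent pullbacks* if for every smooth map $f\colon N\to M$ the pullback of $q$ along $f$ exists in $\mathsf{Smooth}$ and is a tangent pullback. The map $q$ is a *tangent display map* if $\mathrm T^nq$ admits all tangent pullbacks for every $n\ge 0$. It is a *submersion in the tangent-categorical sense* if the naturality square $q\circ p_E=p_M\circ\mathrm Tq$ is a weak tangent pullback, that is, exhibits $\mathrm TE$ as a weak tangent pullback of $p_M\colon\mathrm TM\to M$ and $q\colon E\to M$. It is a *display submersion* if it is both a submersion in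 the tangent-categorical sense and a tangent display map. A *tangent display system* is a family $\mathscr D$ of smooth maps such that (i) every member of $\mathscr D$ admits all tangent pullbacks; (ii) whenever $q\colon E\to M$ is in $\mathscr D$ and a square is a tangent pullback of $q$ along a map $f\colon N\to M$, the pulled-back map $N\times_ME\to N$ is in $\mathscr D$; (iii) if $q\in\mathscr D$ then $\mathrm Tq\in\mathscr D$. **Theorem.** For a smooth map $q\colon E\to M$ between finite-dimensional smooth manifolds the following are equivalent: 1. $q$ is a submersion in the usual sense, i.e. its differential $\mathrm d_aq\colon\mathrm T_aE\to\mathrm T_{q(a)}M$ is surjective for every $a\in E$; 2. $q$ is a submersion in the tangent-categorical sense; 3. $q$ is a display submersion; 4. $q$ is a tangent display map. In particular, the family of submersions is the maximal (that is, the largest with respect to inclusion) tangent display system of $\mathsf{Smooth}$, and it coincides with the family $\mathscr S(\mathsf{Smooth})$ of display submersions. -/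

import Mathlib

open CategoryTheory CategoryTheory.Limits
open scoped Manifold ContDiff

/-! ### Display maps and submersions for a category with an endofunctor -/

namespace TangentCat

universe v u

/-- The `n`-th iterate `Tⁿ` of an endofunctor. -/
def iter {C : Type u} [Category.{v} C] (T : C ⥤ C) : ℕ → (C ⥤ C)
  | 0 => 𝟭 C
  | n + 1 => T ⋙ iter T n

/-- A commutative square is a weak pullback if it is a weak limit cone: it satisfies the existence,
but not necessarily the uniqueness, part of the universal property of a pullback. -/
structure IsWeakPullback {C : Type u} [Category.{v} C] {P X Y Z : C}
    (fst : P ⟶ X) (snd : P ⟶ Y) (f : X ⟶ Z) (g : Y ⟶ Z) : Prop extends CommSq fst snd f g where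
  isWeakLimit' : Nonempty (IsWeakLimit (PullbackCone.mk fst snd w))

/-- A pullback square preserved by all iterates `Tⁿ`. -/
def IsTPullback {C : Type u} [Category.{v} C] (T : C ⥤ C) {P X Y Z : C}
    (fst : P ⟶ X) (snd : P ⟶ Y) (f : X ⟶ Z) (g : Y ⟶ Z) : Prop :=
  IsPullback fst snd f g ∧
    ∀ n : ℕ, 0 < n → IsPullback ((iter T n).map fst) ((iter T n).map snd)
      ((iter T n).map f) ((iter T n).map g)

/-- A weak pullback square that all iterates `Tⁿ` send to weak pullback squares. -/
def IsWeakTPullback {C : Type u} [Category.{v} C] (T : C ⥤ C) {P X Y Z : C}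
    (fst : P ⟶ X) (snd : P ⟶ Y) (f : X ⟶ Z) (g : Y ⟶ Z) : Prop :=
  IsWeakPullback fst snd f g ∧
    ∀ n : ℕ, 0 < n → IsWeakPullback ((iter T n).map fst) ((iter T n).map snd)
      ((iter T n).map f) ((iter T n).map g)

/-- `q : E ⟶ M` is a display map if its pullback along every morphism `f : N ⟶ M` exists. -/
def IsDisplayMap {C : Type u} [Category.{v} C] {E M : C} (q : E ⟶ M) : Prop :=
  ∀ ⦃N : C⦄ (f : N ⟶ M), HasPullback f q

/-- `q` admits all `T`-pullbacks: it is a display map and all of its pullbacks are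
`T`-pullbacks. -/
def AdmitsAllTPullbacks {C : Type u} [Category.{v} C] (T : C ⥤ C) {E M : C} (q : E ⟶ M) : Prop :=
  IsDisplayMap q ∧
    ∀ ⦃P N : C⦄ (π₁ : P ⟶ N) (π₂ : P ⟶ E) (f : N ⟶ M),
      IsPullback π₁ π₂ f q → IsTPullback T π₁ π₂ f q

/-- A `T`-display map: `Tⁿ q` admits all `T`-pullbacks, for every `n ≥ 0`. -/
def IsTDisplayMap {C : Type u} [Category.{v} C] (T : C ⥤ C) {E M : C} (q : E ⟶ M) : Prop :=
  ∀ n : ℕ, AdmitsAllTPullbacks T ((iter T n).map q)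

/-- A family of morphisms is closed under `T`-pullbacks: whenever a `T`-pullback of a member exists,
the pulled-back morphism is a member. -/
def ClosedUnderTPullbacks {C : Type u} [Category.{v} C] (T : C ⥤ C)
    (D : MorphismProperty C) : Prop :=
  ∀ ⦃P N E M : C⦄ (π₁ : P ⟶ N) (π₂ : P ⟶ E) (f : N ⟶ M) (q : E ⟶ M),
    D q → IsTPullback T π₁ π₂ f q → D π₁

/-- A `T`-display system: a family of morphisms that is stable under `T`-pullbacks (closed under
`T`-pullbacks, and each member admits all `T`-pullbacks) and stable under `T`. -/
structure IsTDisplaySystem {C : Type u} [Category.{v} C] (T : C ⥤ C)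
    (D : MorphismProperty C) : Prop where
  closed : ClosedUnderTPullbacks T D
  admits : ∀ ⦃E M : C⦄ (q : E ⟶ M), D q → AdmitsAllTPullbacks T q
  map : ∀ ⦃E M : C⦄ (q : E ⟶ M), D q → D (T.map q)

/-- A submersion with respect to an endofunctor `T` and a natural transformation `p : T ⟶ 𝟭`:
the naturality square of `p` at `q` is a weak `T`-pullback. -/
def IsSubmersion {C : Type u} [Category.{v} C] {T : C ⥤ C} (p : T ⟶ 𝟭 C) {E M : C}
    (q : E ⟶ M) : Prop :=
  IsWeakTPullback T (T.map q) (p.app E) (p.app M) q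

/-- A display submersion: a submersion that is also a `T`-display map. -/
def IsDisplaySubmersion {C : Type u} [Category.{v} C] {T : C ⥤ C} (p : T ⟶ 𝟭 C) {E M : C}
    (q : E ⟶ M) : Prop :=
  IsSubmersion p q ∧ IsTDisplayMap T q

/-- The family of submersions. -/
def submersions {C : Type u} [Category.{v} C] {T : C ⥤ C} (p : T ⟶ 𝟭 C) : MorphismProperty C :=
  fun _ _ q => IsSubmersion p q

/-- The family of display submersions. -/
def displaySubmersions {C : Type u} [Category.{v} C] {T : C ⥤ C} (p : T ⟶ 𝟭 C) :
    MorphismProperty C :=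
  fun _ _ q => IsDisplaySubmersion p q

end TangentCat

/-! ### The category of finite-dimensional smooth manifolds and its tangent bundle functor -/

/-- A finite-dimensional smooth manifold: a Hausdorff second countable space with a smooth
structure without boundary, modelled on a finite-dimensional real normed space. -/
structure Smooth : Type 1 where
  /-- the underlying set -/
  carrier : Type
  /-- the model vector space -/
  E : Type
  /-- the local model, homeomorphic to `E` by boundarylessness -/
  H : Type
  [normedAddCommGroup : NormedAddCommGroup E]
  [normedSpace : NormedSpace ℝ E]
  [finiteDimensional : FiniteDimensional ℝ E]
  [topH : TopologicalSpace H]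
  /-- the model with corners -/
  I : ModelWithCorners ℝ E H
  [boundaryless : I.Boundaryless]
  [top : TopologicalSpace carrier]
  [chartedSpace : ChartedSpace H carrier]
  [isManifold : IsManifold I ∞ carrier]
  [t2 : T2Space carrier]
  [secondCountable : SecondCountableTopology carrier]

namespace Smooth

attribute [instance] normedAddCommGroup normedSpace finiteDimensional topH boundaryless top
  chartedSpace isManifold t2 secondCountable

instance : CoeSort Smooth Type := ⟨Smooth.carrier⟩

/-- Morphisms are the smooth maps. -/
noncomputable instance : Category Smooth where
  Hom M N := C^∞⟮M.I, M; N.I, N⟯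
  id M := ContMDiffMap.id
  comp f g := ContMDiffMap.comp g f

/-- The smooth map underlying a morphism. -/
def toMap {M N : Smooth} (f : M ⟶ N) : C^∞⟮M.I, M; N.I, N⟯ := f

instance tangentBundle_t2 (M : Smooth) : T2Space (TangentBundle M.I M) := by
  refine ⟨fun x y hxy => ?_⟩
  by_cases h : x.proj = y.proj
  · let e := trivializationAt M.E (TangentSpace M.I : M → Type _) x.proj
    have hx : x ∈ e.source := by
      rw [e.mem_source]; exact FiberBundle.mem_baseSet_trivializationAt' x.proj
    have hy : y ∈ e.source := by
      rw [e.mem_source, ← h]; exact FiberBundle.mem_baseSet_trivializationAt' x.proj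
    have hne : e x ≠ e y := fun h' => hxy (e.injOn hx hy h')
    obtain ⟨U, V, hU, hV, hxU, hyV, hd⟩ := t2_separation hne
    refine ⟨e.source ∩ e ⁻¹' U, e.source ∩ e ⁻¹' V,
      e.toOpenPartialHomeomorph.isOpen_inter_preimage hU,
      e.toOpenPartialHomeomorph.isOpen_inter_preimage hV, ⟨hx, hxU⟩, ⟨hy, hyV⟩, ?_⟩
    exact (hd.preimage e).mono Set.inter_subset_right Set.inter_subset_right
  · obtain ⟨U, V, hU, hV, hxU, hyV, hd⟩ := t2_separation h
    have hc : Continuous (Bundle.TotalSpace.proj : TangentBundle M.I M → M) :=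
      FiberBundle.continuous_proj M.E (TangentSpace M.I : M → Type _)
    exact ⟨_, _, hU.preimage hc, hV.preimage hc, hxU, hyV, hd.preimage _⟩

instance tangentBundle_secondCountable (M : Smooth) :
    SecondCountableTopology (TangentBundle M.I M) := by
  have : SecondCountableTopology M.H := M.I.secondCountableTopology
  have : SecondCountableTopology (ModelProd M.H M.E) :=
    inferInstanceAs (SecondCountableTopology (M.H × M.E))
  obtain ⟨s, hs, hsU⟩ := TopologicalSpace.countable_cover_nhds
    (fun x : M => (chartAt M.H x).open_source.mem_nhds (mem_chart_source M.H x))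
  refine ChartedSpace.secondCountable_of_countable_cover (ModelProd M.H M.E)
    (s := (fun x : M => (⟨x, 0⟩ : TangentBundle M.I M)) '' s) ?_ (hs.image _)
  refine Set.eq_univ_of_forall fun y => ?_
  have hy : y.proj ∈ ⋃ x ∈ s, (chartAt M.H x).source := by rw [hsU]; trivial
  obtain ⟨x, hx, hxy⟩ := Set.mem_iUnion₂.1 hy
  refine Set.mem_iUnion₂.2 ⟨⟨x, 0⟩, ⟨x, hx, rfl⟩, ?_⟩
  rw [TangentBundle.mem_chart_source_iff]
  exact hxy

/-- The tangent bundle of a manifold, with its usual smooth structure. -/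
noncomputable def tangentBundle (M : Smooth) : Smooth where
  carrier := TangentBundle M.I M
  E := M.E × M.E
  H := ModelProd M.H M.E
  I := M.I.tangent
  boundaryless := inferInstanceAs (M.I.prod 𝓘(ℝ, M.E)).Boundaryless

/-- The tangent bundle functor `T`: a smooth map `f` is sent to `(x, v) ↦ (f x, df_x v)`. -/
noncomputable def T : Smooth ⥤ Smooth where
  obj M := M.tangentBundle
  map {M N} f := (⟨tangentMap M.I N.I (toMap f),
    (toMap f).contMDiff.contMDiff_tangentMap (m := ∞) (by simp)⟩ :
      C^∞⟮M.I.tangent, TangentBundle M.I M; N.I.tangent, TangentBundle N.I N⟯)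
  map_id M := ContMDiffMap.coe_injective tangentMap_id
  map_comp f g := ContMDiffMap.coe_injective (tangentMap_comp
    ((toMap g).contMDiff.mdifferentiable (by simp))
    ((toMap f).contMDiff.mdifferentiable (by simp)))

/-- The tangent bundle projection `p : T ⟶ 𝟭`. -/
noncomputable def p : T ⟶ 𝟭 Smooth where
  app M := (⟨Bundle.TotalSpace.proj, Bundle.contMDiff_proj (TangentSpace M.I)⟩ :
    C^∞⟮M.I.tangent, TangentBundle M.I M; M.I, M⟯)
  naturality _ _ _ := rfl

/-- A submersion in the usual sense: the differential is surjective at every point. -/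
def IsUsualSubmersion {M N : Smooth} (q : M ⟶ N) : Prop :=
  ∀ x : M, Function.Surjective (mfderiv M.I N.I (toMap q) x)

end Smooth

/-! The usual notion of submersion is the hub of all implications. A submersion `q` is locally a
projection (`exists_submersionChart`), which makes the set-theoretic fibre product along any `f` a
manifold. The resulting square is transverse in the sense of `IsTransversePullback`: points and
tangent vectors match, dimensions add up, and `P` is locally a smooth retract of `N × E`. Transverse
squares are pullbacks and are stable under `T` (`IsTransversePullback.tangent`), so by induction
they are tangent pullbacks, and `q` is a tangent display map. For the weak pullback condition, let
`P` be the pullback of `p_M` along `q`. Lifting tangent vectors through `dq` is an affine problem in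
each fibre, so local lifts glue by a partition of unity (`exists_contMDiff_tangent_lift`) to a
section of `TE → P`. Functors preserve sections, which settles all `Tⁿ` at once. Conversely, testing
the weak pullback on points returns surjectivity of `dq`. The remaining point is that tangent
pullbacks force `q` to be a submersion. If `u` is not in the image of `d_a q`, take a curve through
`q a` at time `0` with zero velocity and at time `π` with velocity a nonzero multiple of `u`
(`exists_contMDiff_curve`). A pullback `P` preserved by `T` has tangent space `ker (dγ - dq)` at
each point. This kernel is `ℝ × ker dq` over `(0, a)` and `0 × ker dq` over `(π, a)`, whereas `P`
has a single dimension. -/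

/-! ### Local form of submersions -/

/-- The local form of a smooth map with surjective derivative, in normed spaces: completing it by a
linear map gives a local diffeomorphism. -/
theorem ContDiffOn.exists_openPartialHomeomorph_prod {E F K : Type*}
    [NormedAddCommGroup E] [NormedSpace ℝ E] [FiniteDimensional ℝ E]
    [NormedAddCommGroup F] [NormedSpace ℝ F] [FiniteDimensional ℝ F]
    [NormedAddCommGroup K] [NormedSpace ℝ K] [FiniteDimensional ℝ K]
    (hK : Module.finrank ℝ K = Module.finrank ℝ E - Module.finrank ℝ F)
    {f : E → F} {U : Set E} (hU : IsOpen U) (hf : ContDiffOn ℝ ∞ f U) {x₀ : E} (hx₀ : x₀ ∈ U)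
    (hs : Function.Surjective (fderiv ℝ f x₀)) :
    ∃ (L : E →L[ℝ] K) (e : OpenPartialHomeomorph E (F × K)), x₀ ∈ e.source ∧ e.source ⊆ U ∧
      (∀ x, e x = (f x, L x)) ∧ ContDiffOn ℝ ∞ e.symm e.target := by
  have : CompleteSpace E := FiniteDimensional.complete ℝ E
  set A := fderiv ℝ f x₀
  have hrank : Module.finrank ℝ (LinearMap.ker A.toLinearMap) = Module.finrank ℝ K := by
    have h1 := LinearMap.finrank_range_add_finrank_ker A.toLinearMap
    rw [LinearMap.range_eq_top.2 hs, finrank_top] at h1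
    omega
  -- `L` is the projection onto `ker A` along a complement `C`, followed by an isomorphism with `K`.
  -- Its kernel `C` is complementary to `ker A`, so `(A, L)` is invertible.
  obtain ⟨C, hC⟩ := Submodule.exists_isCompl (LinearMap.ker A.toLinearMap)
  let i : LinearMap.ker A.toLinearMap ≃ₗ[ℝ] K := LinearEquiv.ofFinrankEq _ _ hrank
  let L₀ : E →ₗ[ℝ] K := i.toLinearMap ∘ₗ Submodule.projectionOnto _ C hC
  let L : E →L[ℝ] K := LinearMap.toContinuousLinearMap L₀
  have hLs : Function.Surjective L := by
    intro z
    refine ⟨(i.symm z : E), ?_⟩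
    change i (Submodule.projectionOnto _ C hC _) = z
    simp
  have hLk : LinearMap.ker L.toLinearMap = C := by
    change LinearMap.ker L₀ = C
    rw [LinearEquiv.ker_comp, Submodule.ker_projectionOnto]
  let D : E ≃L[ℝ] F × K := A.equivProdOfSurjectiveOfIsCompl L (LinearMap.range_eq_top.2 hs)
    (LinearMap.range_eq_top.2 hLs) (by rw [hLk]; exact hC)
  let g : E → F × K := fun x => (f x, L x)
  have hg : ContDiffOn ℝ ∞ g U := hf.prodMk L.contDiff.contDiffOn
  have hgx : ∀ x ∈ U, ContDiffAt ℝ ∞ g x := fun x hx => hg.contDiffAt (hU.mem_nhds hx)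
  have hD : HasFDerivAt g (D : E →L[ℝ] F × K) x₀ :=
    ((hf.contDiffAt (hU.mem_nhds hx₀)).differentiableAt (by simp)).hasFDerivAt.prodMk L.hasFDerivAt
  let e₀ := (hgx x₀ hx₀).toOpenPartialHomeomorph g hD (by simp)
  -- The local homeomorphism `e₀` has a smooth inverse wherever the derivative of `g` is invertible,
  -- so its source is cut down to the open set of such points.
  let V : Set E := U ∩ fderiv ℝ g ⁻¹' Set.range ((↑) : (E ≃L[ℝ] F × K) → E →L[ℝ] F × K)
  have hV : IsOpen V := (hg.continuousOn_fderiv_of_isOpen hU (by simp)).isOpen_inter_preimage hU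
    ContinuousLinearEquiv.isOpen
  have hxV : x₀ ∈ V := ⟨hx₀, D, hD.fderiv.symm⟩
  refine ⟨L, e₀.restrOpen V hV, ⟨(hgx x₀ hx₀).mem_toOpenPartialHomeomorph_source hD _, hxV⟩,
    fun x hx => hx.2.1, fun x => rfl, ?_⟩
  intro y hy
  have hys : (e₀.restrOpen V hV).symm y ∈ V := ((e₀.restrOpen V hV).map_target hy).2
  obtain ⟨hyU, B, hB⟩ := hys
  refine ((e₀.restrOpen V hV).contDiffAt_symm (f₀' := B) hy ?_ (hgx _ hyU)).contDiffWithinAt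
  rw [hB]
  exact ((hgx _ hyU).differentiableAt (by simp)).hasFDerivAt

section

variable {EX HX X EY HY Y : Type*}
  [NormedAddCommGroup EX] [NormedSpace ℝ EX] [TopologicalSpace HX] [TopologicalSpace X]
  [ChartedSpace HX X] (IX : ModelWithCorners ℝ EX HX)
  [NormedAddCommGroup EY] [NormedSpace ℝ EY] [TopologicalSpace HY] [TopologicalSpace Y]
  [ChartedSpace HY Y] (IY : ModelWithCorners ℝ EY HY)
  (K : Type*) [NormedAddCommGroup K] [NormedSpace ℝ K]

/-- A local identification of `q : X → Y` with the projection `Y × K → Y`. -/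
structure SubmersionChart (q : X → Y) where
  /-- the fibre coordinate -/
  coord : X → K
  /-- the local parametrization, inverse to `(q, coord)` -/
  param : Y × K → X
  source : Set X
  target : Set (Y × K)
  isOpen_source : IsOpen source
  isOpen_target : IsOpen target
  contMDiffOn_coord : ContMDiffOn IX 𝓘(ℝ, K) ∞ coord source
  contMDiffOn_param : ContMDiffOn (IY.prod 𝓘(ℝ, K)) IX ∞ param target
  map_source : ∀ x ∈ source, (q x, coord x) ∈ target
  map_target : ∀ z ∈ target, param z ∈ source
  left_inv : ∀ x ∈ source, param (q x, coord x) = x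
  apply_param : ∀ z ∈ target, q (param z) = z.1
  coord_param : ∀ z ∈ target, coord (param z) = z.2

variable {IX IY K}

/-- The normed-space local form is applied to `q` read in extended charts. Since there is no
boundary, chart domains and targets are open and `mfderiv` is the ordinary derivative `fderiv` of
the coordinate expression. -/
theorem exists_submersionChart [FiniteDimensional ℝ EX] [FiniteDimensional ℝ EY]
    [FiniteDimensional ℝ K] [IX.Boundaryless] [IY.Boundaryless] [IsManifold IX ∞ X]
    [IsManifold IY ∞ Y]
    (hK : Module.finrank ℝ K = Module.finrank ℝ EX - Module.finrank ℝ EY)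
    {q : X → Y} (hq : ContMDiff IX IY ∞ q) {x₀ : X}
    (hs : Function.Surjective (mfderiv IX IY q x₀)) :
    ∃ c : SubmersionChart IX IY K q, x₀ ∈ c.source := by
  let φ := extChartAt IX x₀
  let χ := extChartAt IY (q x₀)
  let f : EX → EY := χ ∘ q ∘ φ.symm
  let U : Set EX := φ.target ∩ φ.symm ⁻¹' (q ⁻¹' χ.source)
  have hφs : ContMDiffOn 𝓘(ℝ, EX) IX ∞ φ.symm φ.target := contMDiffOn_extChartAt_symm x₀
  have hφ : ContMDiffOn IX 𝓘(ℝ, EX) ∞ φ φ.source := by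
    simpa [φ] using contMDiffOn_extChartAt (I := IX) (x := x₀) (n := ∞)
  have hχ : ContMDiffOn IY 𝓘(ℝ, EY) ∞ χ χ.source := by
    simpa [χ] using contMDiffOn_extChartAt (I := IY) (x := q x₀) (n := ∞)
  have hφo : IsOpen φ.source := isOpen_extChartAt_source x₀
  have hχo : IsOpen χ.source := isOpen_extChartAt_source (q x₀)
  have hU : IsOpen U := hφs.continuousOn.isOpen_inter_preimage (isOpen_extChartAt_target x₀)
    (hχo.preimage hq.continuous)
  have hf : ContDiffOn ℝ ∞ f U := by
    rw [← contMDiffOn_iff_contDiffOn]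
    exact hχ.comp (hq.comp_contMDiffOn (hφs.mono fun x hx => hx.1)) fun x hx => hx.2
  have hx₀ : φ x₀ ∈ U := ⟨mem_extChartAt_target x₀, by
    simp only [Set.mem_preimage, φ, extChartAt_to_inv]; exact mem_extChartAt_source (q x₀)⟩
  have hmf : mfderiv IX IY q x₀ = fderiv ℝ f (φ x₀) := by
    rw [(hq.mdifferentiable (by simp) x₀).mfderiv, IX.range_eq_univ, fderivWithin_univ]
    rfl
  obtain ⟨L, e, hxe, heU, he, hes⟩ := hf.exists_openPartialHomeomorph_prod hK hU hx₀
    (by rw [hmf] at hs; exact hs)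
  have hχm : ContMDiffOn (IY.prod 𝓘(ℝ, K)) 𝓘(ℝ, EY × K) ∞ (fun z : Y × K => (χ z.1, z.2))
      (Prod.fst ⁻¹' χ.source) :=
    (hχ.comp contMDiffOn_fst fun z hz => hz).prodMk_space contMDiffOn_snd
  have hsrc : ∀ x ∈ φ.source ∩ φ ⁻¹' e.source, q x ∈ χ.source := by
    intro x hx
    have := (heU hx.2).2
    simpa [φ.left_inv hx.1] using this
  have hfx : ∀ x ∈ φ.source, f (φ x) = χ (q x) := fun x hx => by
    simp [f, φ.left_inv hx]
  refine ⟨{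
    coord := fun x => L (φ x)
    param := fun z => φ.symm (e.symm (χ z.1, z.2))
    source := φ.source ∩ φ ⁻¹' e.source
    target := {z | z.1 ∈ χ.source ∧ (χ z.1, z.2) ∈ e.target}
    isOpen_source := hφ.continuousOn.isOpen_inter_preimage hφo e.open_source
    isOpen_target := hχm.continuousOn.isOpen_inter_preimage (hχo.preimage continuous_fst)
      e.open_target
    contMDiffOn_coord := L.contDiff.contMDiff.comp_contMDiffOn (hφ.mono Set.inter_subset_left)
    contMDiffOn_param := hφs.comp (hes.contMDiffOn.comp (hχm.mono fun z hz => hz.1)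
      fun z hz => hz.2) fun z hz => (heU (e.map_target hz.2)).1
    map_source := ?_
    map_target := ?_
    left_inv := ?_
    apply_param := ?_
    coord_param := ?_ }, mem_extChartAt_source x₀, hxe⟩
  · intro x hx
    refine ⟨hsrc x hx, ?_⟩
    have := e.map_source hx.2
    rwa [he, hfx x hx.1] at this
  · intro z hz
    have := heU (e.map_target hz.2)
    refine ⟨φ.map_target this.1, ?_⟩
    simp only [Set.mem_preimage, φ.right_inv this.1]
    exact e.map_target hz.2
  · intro x hx
    have := e.left_inv hx.2
    rw [he, hfx x hx.1] at this
    simp only [this, φ.left_inv hx.1]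
  · intro z hz
    have h1 := heU (e.map_target hz.2)
    have h2 := e.right_inv hz.2
    rw [he] at h2
    have h3 : χ (q (φ.symm (e.symm (χ z.1, z.2)))) = χ z.1 := congrArg Prod.fst h2
    exact χ.injOn h1.2 hz.1 h3
  · intro z hz
    have h1 := heU (e.map_target hz.2)
    have h2 := e.right_inv hz.2
    rw [he] at h2
    simp only [φ.right_inv h1.1]
    exact congrArg Prod.snd h2

end

/-! ### Tangent maps of submersions -/

section

open Bundle Filter Topology

variable {EX HX X EY HY Y EZ HZ Z : Type*}
  [NormedAddCommGroup EX] [NormedSpace ℝ EX] [TopologicalSpace HX] [TopologicalSpace X]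
  [ChartedSpace HX X] {IX : ModelWithCorners ℝ EX HX}
  [NormedAddCommGroup EY] [NormedSpace ℝ EY] [TopologicalSpace HY] [TopologicalSpace Y]
  [ChartedSpace HY Y] {IY : ModelWithCorners ℝ EY HY}
  [NormedAddCommGroup EZ] [NormedSpace ℝ EZ] [TopologicalSpace HZ] [TopologicalSpace Z]
  [ChartedSpace HZ Z] {IZ : ModelWithCorners ℝ EZ HZ}
  {K : Type*} [NormedAddCommGroup K] [NormedSpace ℝ K]

theorem tangentMap_congr_of_eventuallyEq {f g : X → Y} {v : TangentBundle IX X}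
    (h : f =ᶠ[𝓝 v.proj] g) : tangentMap IX IY f v = tangentMap IX IY g v := by
  refine TotalSpace.ext h.eq_of_nhds ?_
  rw [tangentMap, tangentMap, h.mfderiv_eq, h.eq_of_nhds]

theorem ContMDiffOn.contMDiffOn_tangentMap [IsManifold IX ∞ X] [IsManifold IY ∞ Y]
    {f : X → Y} {s : Set X} (hf : ContMDiffOn IX IY ∞ f s) (hs : IsOpen s) :
    ContMDiffOn IX.tangent IY.tangent ∞ (tangentMap IX IY f)
      (TotalSpace.proj ⁻¹' s : Set (TangentBundle IX X)) :=
  (hf.contMDiffOn_tangentMapWithin (m := ∞) (by simp) hs.uniqueMDiffOn).congr fun v hv =>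
    (tangentMapWithin_eq_tangentMap (hs.uniqueMDiffOn v.1 hv)
      ((hf.contMDiffAt (hs.mem_nhds hv)).mdifferentiableAt (by simp))).symm

theorem equivTangentBundleProd_symm_tangentMap {f : X → Y} {g : X → Z} {v : TangentBundle IX X}
    (hf : MDifferentiableAt IX IY f v.proj) (hg : MDifferentiableAt IX IZ g v.proj) :
    (equivTangentBundleProd IY Y IZ Z).symm (tangentMap IX IY f v, tangentMap IX IZ g v) =
      tangentMap IX (IY.prod IZ) (fun x => (f x, g x)) v := by
  refine TotalSpace.ext rfl (heq_of_eq ?_)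
  change _ = (mfderiv IX (IY.prod IZ) (fun x => (f x, g x)) v.proj) v.2
  rw [mfderiv_prodMk hf hg]
  rfl

theorem tangentMap_fst_equivTangentBundleProd_symm
    (z : TangentBundle IX X × TangentBundle IY Y) :
    tangentMap (IX.prod IY) IX Prod.fst ((equivTangentBundleProd IX X IY Y).symm z) = z.1 := by
  rw [tangentMap_prodFst]
  rfl

theorem surjective_mfderiv_of_local_section {q : X → Y} {σ : Y → X} {x : X}
    (hq : MDifferentiableAt IX IY q x) (hσ : MDifferentiableAt IY IX σ (q x)) (hx : σ (q x) = x)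
    (h : q ∘ σ =ᶠ[𝓝 (q x)] id) : Function.Surjective (mfderiv IX IY q x) := by
  intro w
  have hq' : MDifferentiableAt IX IY q (σ (q x)) := by rwa [hx]
  have h1 := mfderiv_comp (q x) hq' hσ
  rw [h.mfderiv_eq, mfderiv_id] at h1
  have h2 : w = mfderiv IX IY q (σ (q x)) (mfderiv IY IX σ (q x) w) := congrArg (· w) h1
  rw [hx] at h2
  exact ⟨_, h2.symm⟩

namespace SubmersionChart

variable {q : X → Y} (c : SubmersionChart IX IY K q)

theorem mdifferentiableAt_coord {x : X} (hx : x ∈ c.source) :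
    MDifferentiableAt IX 𝓘(ℝ, K) c.coord x :=
  (c.contMDiffOn_coord.contMDiffAt (c.isOpen_source.mem_nhds hx)).mdifferentiableAt (by simp)

theorem mdifferentiableAt_param {z : Y × K} (hz : z ∈ c.target) :
    MDifferentiableAt (IY.prod 𝓘(ℝ, K)) IX c.param z :=
  (c.contMDiffOn_param.contMDiffAt (c.isOpen_target.mem_nhds hz)).mdifferentiableAt (by simp)

/-- The tangent map of the local parametrization, as a function of two tangent vectors. -/
noncomputable def tangentParam (z : TangentBundle IY Y × TangentBundle 𝓘(ℝ, K) K) :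
    TangentBundle IX X :=
  tangentMap (IY.prod 𝓘(ℝ, K)) IX c.param ((equivTangentBundleProd IY Y 𝓘(ℝ, K) K).symm z)

theorem contMDiffOn_tangentParam [IsManifold IX ∞ X] [IsManifold IY ∞ Y] :
    ContMDiffOn (IY.tangent.prod 𝓘(ℝ, K).tangent) IX.tangent ∞ c.tangentParam
      {z | (z.1.proj, z.2.proj) ∈ c.target} :=
  (c.contMDiffOn_param.contMDiffOn_tangentMap c.isOpen_target).comp
    contMDiff_equivTangentBundleProd_symm.contMDiffOn fun _ hz => hz

/-- Applying `T` to the identities `apply_param` and, in `tangentParam_tangentMap`, `left_inv` turns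
the local form of `q` into one of `Tq`. -/
theorem tangentMap_tangentParam (hq : MDifferentiable IX IY q)
    (z : TangentBundle IY Y × TangentBundle 𝓘(ℝ, K) K) (hz : (z.1.proj, z.2.proj) ∈ c.target) :
    tangentMap IX IY q (c.tangentParam z) = z.1 := by
  rw [tangentParam, ← tangentMap_comp_at _ (hq _) (c.mdifferentiableAt_param hz)]
  refine Eq.trans (tangentMap_congr_of_eventuallyEq ?_)
    (tangentMap_fst_equivTangentBundleProd_symm z)
  filter_upwards [c.isOpen_target.mem_nhds hz] with y hy using c.apply_param y hy

theorem tangentParam_tangentMap (hq : MDifferentiable IX IY q) (v : TangentBundle IX X)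
    (hv : v.proj ∈ c.source) :
    c.tangentParam (tangentMap IX IY q v, tangentMap IX 𝓘(ℝ, K) c.coord v) = v := by
  have hk := c.mdifferentiableAt_coord hv
  rw [tangentParam, equivTangentBundleProd_symm_tangentMap (hq _) hk,
    ← tangentMap_comp_at _ (c.mdifferentiableAt_param (c.map_source _ hv)) ((hq _).prodMk hk)]
  refine Eq.trans (tangentMap_congr_of_eventuallyEq (g := id) ?_) (congrFun tangentMap_id v)
  filter_upwards [c.isOpen_source.mem_nhds hv] with y hy using c.left_inv y hy

end SubmersionChart

/-- Freezing the fibre coordinate of `v` at `u` makes `tangentParam` a smooth local section of `Tq`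
through `v`. -/
theorem surjective_mfderiv_tangentMap [FiniteDimensional ℝ EX] [FiniteDimensional ℝ EY]
    [IX.Boundaryless] [IY.Boundaryless] [IsManifold IX ∞ X]
    [IsManifold IY ∞ Y] {q : X → Y} (hq : ContMDiff IX IY ∞ q)
    (hs : ∀ x, Function.Surjective (mfderiv IX IY q x)) (v : TangentBundle IX X) :
    Function.Surjective (mfderiv IX.tangent IY.tangent (tangentMap IX IY q) v) := by
  obtain ⟨c, hc⟩ := exists_submersionChart
    (K := EuclideanSpace ℝ (Fin (Module.finrank ℝ EX - Module.finrank ℝ EY))) (by simp) hq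
    (hs v.proj)
  have hqd : MDifferentiable IX IY q := hq.mdifferentiable (by simp)
  let u := tangentMap IX 𝓘(ℝ, EuclideanSpace ℝ (Fin (Module.finrank ℝ EX - Module.finrank ℝ EY)))
    c.coord v
  have hU : IsOpen {w : TangentBundle IY Y | (w.proj, u.proj) ∈ c.target} :=
    c.isOpen_target.preimage ((FiberBundle.continuous_proj EY (TangentSpace IY)).prodMk
      continuous_const)
  have hv : (tangentMap IX IY q v) ∈ {w : TangentBundle IY Y | (w.proj, u.proj) ∈ c.target} :=
    c.map_source _ hc
  have hσ : ContMDiffOn IY.tangent IX.tangent ∞ (fun w => c.tangentParam (w, u))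
      {w : TangentBundle IY Y | (w.proj, u.proj) ∈ c.target} :=
    c.contMDiffOn_tangentParam.comp (contMDiff_id.prodMk contMDiff_const).contMDiffOn
      fun w hw => hw
  refine surjective_mfderiv_of_local_section (σ := fun w => c.tangentParam (w, u))
    ((hq.contMDiff_tangentMap (m := ∞) (by simp)).mdifferentiable (by simp) v)
    ((hσ.contMDiffAt (hU.mem_nhds hv)).mdifferentiableAt (by simp))
    (c.tangentParam_tangentMap hqd v hc) ?_
  filter_upwards [hU.mem_nhds hv] with w hw using c.tangentMap_tangentParam hqd (w, u) hw

end

/-! ### Transverse pullback squares and their stability under `T` -/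

theorem LinearMap.range_eq_ker_of_finrank_add {U V W : Type*} [AddCommGroup U] [Module ℝ U]
    [AddCommGroup V] [Module ℝ V] [AddCommGroup W] [Module ℝ W] [FiniteDimensional ℝ V]
    {A : U →ₗ[ℝ] V} {B : V →ₗ[ℝ] W} (hA : Function.Injective A) (hB : Function.Surjective B)
    (hBA : B ∘ₗ A = 0)
    (hd : Module.finrank ℝ U + Module.finrank ℝ W = Module.finrank ℝ V) :
    LinearMap.range A = LinearMap.ker B := by
  refine Submodule.eq_of_le_of_finrank_eq (LinearMap.range_le_ker_iff.2 hBA) ?_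
  have h := LinearMap.finrank_range_add_finrank_ker B
  rw [LinearMap.range_eq_top.2 hB, finrank_top] at h
  rw [LinearMap.finrank_range_of_inj hA]
  omega

section

open Bundle Filter Topology

variable {EP HP P EN HN N EX HX X EM HM M : Type*}
  [NormedAddCommGroup EP] [NormedSpace ℝ EP] [TopologicalSpace HP] [TopologicalSpace P]
  [ChartedSpace HP P] {IP : ModelWithCorners ℝ EP HP}
  [NormedAddCommGroup EN] [NormedSpace ℝ EN] [TopologicalSpace HN] [TopologicalSpace N]
  [ChartedSpace HN N] {IN : ModelWithCorners ℝ EN HN}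
  [NormedAddCommGroup EX] [NormedSpace ℝ EX] [TopologicalSpace HX] [TopologicalSpace X]
  [ChartedSpace HX X] {IX : ModelWithCorners ℝ EX HX}
  [NormedAddCommGroup EM] [NormedSpace ℝ EM] [TopologicalSpace HM] [TopologicalSpace M]
  [ChartedSpace HM M] {IM : ModelWithCorners ℝ EM HM}

variable (IP IN IX IM) in
/-- A square exhibiting `P` as the transverse fibre product of `f` and `q`, as a submanifold of
`N × X` which is locally a smooth retract. -/
structure IsTransversePullback (π₁ : P → N) (π₂ : P → X) (f : N → M) (q : X → M) : Prop where
  contMDiff_fst : ContMDiff IP IN ∞ π₁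
  contMDiff_snd : ContMDiff IP IX ∞ π₂
  contMDiff_left : ContMDiff IN IM ∞ f
  contMDiff_right : ContMDiff IX IM ∞ q
  comm : ∀ p, f (π₁ p) = q (π₂ p)
  exists_of_eq : ∀ n x, f n = q x → ∃ p, π₁ p = n ∧ π₂ p = x
  surjective_mfderiv : ∀ x, Function.Surjective (mfderiv IX IM q x)
  finrank_add : Nonempty P → Module.finrank ℝ EP + Module.finrank ℝ EM =
    Module.finrank ℝ EN + Module.finrank ℝ EX
  retraction : ∀ p₀, ∃ (r : N × X → P) (O : Set (N × X)), IsOpen O ∧ (π₁ p₀, π₂ p₀) ∈ O ∧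
    ContMDiffOn (IN.prod IX) IP ∞ r O ∧ ∀ p, (π₁ p, π₂ p) ∈ O → r (π₁ p, π₂ p) = p

namespace IsTransversePullback

variable {π₁ : P → N} {π₂ : P → X} {f : N → M} {q : X → M}

theorem injective (h : IsTransversePullback IP IN IX IM π₁ π₂ f q) {p p' : P}
    (h₁ : π₁ p = π₁ p') (h₂ : π₂ p = π₂ p') : p = p' := by
  obtain ⟨r, O, -, hp, -, hr⟩ := h.retraction p'
  rw [← hr p (by rwa [h₁, h₂]), ← hr p' hp, h₁, h₂]

/-- The sequence `T_p P → T N × T X → T M` is exact by a dimension count: the first map is injective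
because the derivative of the retraction is a left inverse, the second is surjective because `dq`
is, and the dimensions add up by `finrank_add`. -/
theorem range_mfderiv [FiniteDimensional ℝ EN] [FiniteDimensional ℝ EX]
    (h : IsTransversePullback IP IN IX IM π₁ π₂ f q) (p : P) {v : EN} {w : EX}
    (hvw : (mfderiv IN IM f (π₁ p) v : EM) = (mfderiv IX IM q (π₂ p) w : EM)) :
    ∃ u : EP, (mfderiv IP IN π₁ p u : EN) = v ∧ (mfderiv IP IX π₂ p u : EX) = w := by
  have h₁ : MDifferentiableAt IP IN π₁ p := h.contMDiff_fst.mdifferentiable (by simp) p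
  have h₂ : MDifferentiableAt IP IX π₂ p := h.contMDiff_snd.mdifferentiable (by simp) p
  have hf : MDifferentiableAt IN IM f (π₁ p) := h.contMDiff_left.mdifferentiable (by simp) _
  have hq : MDifferentiableAt IX IM q (π₂ p) := h.contMDiff_right.mdifferentiable (by simp) _
  let A₁ : EP →L[ℝ] EN := mfderiv IP IN π₁ p
  let A₂ : EP →L[ℝ] EX := mfderiv IP IX π₂ p
  let B₁ : EN →L[ℝ] EM := mfderiv IN IM f (π₁ p)
  let B₂ : EX →L[ℝ] EM := mfderiv IX IM q (π₂ p)
  have hB₂ : Function.Surjective B₂ := h.surjective_mfderiv (π₂ p)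
  let A : EP →ₗ[ℝ] EN × EX := (A₁.prod A₂).toLinearMap
  let B : EN × EX →ₗ[ℝ] EM := (B₁.coprod (-B₂)).toLinearMap
  have hA : Function.Injective A := by
    obtain ⟨r, O, hO, hp, hr, hrp⟩ := h.retraction p
    have hrd : MDifferentiableAt (IN.prod IX) IP r (π₁ p, π₂ p) :=
      (hr.contMDiffAt (hO.mem_nhds hp)).mdifferentiableAt (by simp)
    have h12 := h₁.prodMk h₂
    have hcomp : mfderiv IP IP (r ∘ fun p => (π₁ p, π₂ p)) p = ContinuousLinearMap.id ℝ _ := by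
      rw [← mfderiv_id]
      apply Filter.EventuallyEq.mfderiv_eq
      filter_upwards [h12.continuousAt.preimage_mem_nhds (hO.mem_nhds hp)] with y hy
      exact hrp y hy
    rw [mfderiv_comp p hrd h12, mfderiv_prodMk h₁ h₂] at hcomp
    have hl : Function.LeftInverse (mfderiv (IN.prod IX) IP r (π₁ p, π₂ p) : EN × EX → EP) A :=
      fun u => congrArg (fun L : EP →L[ℝ] EP => L u) hcomp
    exact hl.injective
  have hB : Function.Surjective B := fun z => by
    obtain ⟨w, hw⟩ := hB₂ (-z)
    exact ⟨(0, w), by simp [B, hw]⟩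
  have hBA : B ∘ₗ A = 0 := by
    have h3 : mfderiv IP IM (f ∘ π₁) p = mfderiv IP IM (q ∘ π₂) p := by
      have : f ∘ π₁ = q ∘ π₂ := funext h.comm
      rw [this]
    rw [mfderiv_comp p hf h₁, mfderiv_comp p hq h₂] at h3
    ext u
    have h4 : B₁ (A₁ u) = B₂ (A₂ u) := congrArg (fun L : EP →L[ℝ] EM => L u) h3
    simp [A, B, h4]
  have hr := LinearMap.range_eq_ker_of_finrank_add hA hB hBA
    (by rw [h.finrank_add ⟨p⟩, Module.finrank_prod])
  have hmem : (v, w) ∈ LinearMap.ker B := by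
    have h5 : B₁ v = B₂ w := hvw
    simp [B, h5]
  rw [← hr] at hmem
  obtain ⟨u, hu⟩ := hmem
  exact ⟨u, congrArg Prod.fst hu, congrArg Prod.snd hu⟩

/-- Every clause of transversality passes to tangent bundles: existence of points uses
`range_mfderiv` in the fibres, all dimensions double, and the tangent map of a retraction is again a
retraction. -/
theorem tangent [FiniteDimensional ℝ EP] [FiniteDimensional ℝ EN] [FiniteDimensional ℝ EX]
    [FiniteDimensional ℝ EM] [IX.Boundaryless] [IM.Boundaryless]
    [IsManifold IP ∞ P] [IsManifold IN ∞ N] [IsManifold IX ∞ X] [IsManifold IM ∞ M]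
    (h : IsTransversePullback IP IN IX IM π₁ π₂ f q) :
    IsTransversePullback IP.tangent IN.tangent IX.tangent IM.tangent
      (tangentMap IP IN π₁) (tangentMap IP IX π₂) (tangentMap IN IM f) (tangentMap IX IM q) where
  contMDiff_fst := h.contMDiff_fst.contMDiff_tangentMap (by simp)
  contMDiff_snd := h.contMDiff_snd.contMDiff_tangentMap (by simp)
  contMDiff_left := h.contMDiff_left.contMDiff_tangentMap (by simp)
  contMDiff_right := h.contMDiff_right.contMDiff_tangentMap (by simp)
  comm u := by
    rw [← tangentMap_comp_at _ (h.contMDiff_left.mdifferentiable (by simp) _)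
      (h.contMDiff_fst.mdifferentiable (by simp) _),
      ← tangentMap_comp_at _ (h.contMDiff_right.mdifferentiable (by simp) _)
      (h.contMDiff_snd.mdifferentiable (by simp) _), (funext h.comm : f ∘ π₁ = q ∘ π₂)]
  exists_of_eq := by
    rintro ⟨n, v⟩ ⟨x, w⟩ hvw
    have hb : f n = q x := congrArg TotalSpace.proj hvw
    obtain ⟨p, rfl, rfl⟩ := h.exists_of_eq n x hb
    have hd := (TotalSpace.mk.inj hvw).2
    obtain ⟨u, hu₁, hu₂⟩ := h.range_mfderiv p (v := v) (w := w) (eq_of_heq hd)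
    exact ⟨⟨p, u⟩, TotalSpace.ext rfl (heq_of_eq hu₁), TotalSpace.ext rfl (heq_of_eq hu₂)⟩
  surjective_mfderiv := surjective_mfderiv_tangentMap h.contMDiff_right h.surjective_mfderiv
  finrank_add := by
    rintro ⟨u⟩
    have := h.finrank_add ⟨u.proj⟩
    simp only [Module.finrank_prod]
    omega
  retraction := by
    intro u₀
    obtain ⟨r, O, hO, hp, hr, hrp⟩ := h.retraction u₀.proj
    refine ⟨fun z => tangentMap (IN.prod IX) IP r ((equivTangentBundleProd IN N IX X).symm z),
      {z | (z.1.proj, z.2.proj) ∈ O}, ?_, hp, ?_, ?_⟩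
    · exact hO.preimage (((FiberBundle.continuous_proj EN (TangentSpace IN)).comp
        continuous_fst).prodMk ((FiberBundle.continuous_proj EX (TangentSpace IX)).comp
        continuous_snd))
    · exact (hr.contMDiffOn_tangentMap hO).comp
        contMDiff_equivTangentBundleProd_symm.contMDiffOn fun z hz => hz
    · intro u hu
      have h₁ : MDifferentiableAt IP IN π₁ u.proj := h.contMDiff_fst.mdifferentiable (by simp) _
      have h₂ : MDifferentiableAt IP IX π₂ u.proj := h.contMDiff_snd.mdifferentiable (by simp) _
      have hrd : MDifferentiableAt (IN.prod IX) IP r (π₁ u.proj, π₂ u.proj) :=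
        (hr.contMDiffAt (hO.mem_nhds hu)).mdifferentiableAt (by simp)
      have h12 := h₁.prodMk h₂
      simp only
      rw [equivTangentBundleProd_symm_tangentMap h₁ h₂, ← tangentMap_comp_at _ hrd h12]
      refine Eq.trans (tangentMap_congr_of_eventuallyEq (g := id) ?_) (congrFun tangentMap_id u)
      filter_upwards [h12.continuousAt.preimage_mem_nhds (hO.mem_nhds hu)] with y hy
      exact hrp y hy

/-- The universal property of a transverse pullback. -/
theorem exists_lift {EZ HZ Z : Type*} [NormedAddCommGroup EZ] [NormedSpace ℝ EZ]
    [TopologicalSpace HZ] [TopologicalSpace Z] [ChartedSpace HZ Z] {IZ : ModelWithCorners ℝ EZ HZ}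
    (h : IsTransversePullback IP IN IX IM π₁ π₂ f q) {a : Z → N} {b : Z → X}
    (ha : ContMDiff IZ IN ∞ a) (hb : ContMDiff IZ IX ∞ b) (hab : ∀ z, f (a z) = q (b z)) :
    ∃ l : Z → P, ContMDiff IZ IP ∞ l ∧ (∀ z, π₁ (l z) = a z) ∧ ∀ z, π₂ (l z) = b z := by
  -- The lift is chosen pointwise; near `z₀` it agrees with `r ∘ (a, b)` and is therefore smooth.
  choose l hl₁ hl₂ using fun z => h.exists_of_eq _ _ (hab z)
  refine ⟨l, fun z₀ => ?_, hl₁, hl₂⟩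
  obtain ⟨r, O, hO, hp, hr, hrp⟩ := h.retraction (l z₀)
  rw [hl₁, hl₂] at hp
  have hab := ha.prodMk hb
  have hrs : ContMDiffAt IZ IP ∞ (r ∘ fun z => (a z, b z)) z₀ :=
    (hr.contMDiffAt (hO.mem_nhds hp)).comp z₀ (hab z₀)
  refine hrs.congr_of_eventuallyEq ?_
  filter_upwards [hab.continuous.continuousAt.preimage_mem_nhds (hO.mem_nhds hp)] with z hz
  have := hrp (l z) (by rw [hl₁, hl₂]; exact hz)
  rw [hl₁, hl₂] at this
  exact this.symm

end IsTransversePullback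

end

/-! ### The manifold structure on a fibre product -/

section

open Bundle Filter Topology

variable {EN HN N EX HX X EM HM M : Type*}
  [NormedAddCommGroup EN] [NormedSpace ℝ EN] [TopologicalSpace HN] [TopologicalSpace N]
  [ChartedSpace HN N] {IN : ModelWithCorners ℝ EN HN}
  [NormedAddCommGroup EX] [NormedSpace ℝ EX] [TopologicalSpace HX] [TopologicalSpace X]
  [ChartedSpace HX X] {IX : ModelWithCorners ℝ EX HX}
  [NormedAddCommGroup EM] [NormedSpace ℝ EM] [TopologicalSpace HM] [TopologicalSpace M]
  [ChartedSpace HM M] {IM : ModelWithCorners ℝ EM HM}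
  {K : Type*} [NormedAddCommGroup K] [NormedSpace ℝ K]
  {f : N → M} {q : X → M}

/-- The set-theoretic fibre product, with the subspace topology. -/
abbrev FibreProduct (f : N → M) (q : X → M) : Type _ := {z : N × X // f z.1 = q z.2}

namespace SubmersionChart

variable (IN) in
/-- The coordinates `(n, x) ↦ (φ n, coord x)` on a fibre product. -/
noncomputable def fibreCoord (c : SubmersionChart IX IM K q) (n₀ : N) (z : N × X) : EN × K :=
  (extChartAt IN n₀ z.1, c.coord z.2)

variable (IN f) in
/-- The parametrization `(y, t) ↦ (φ⁻¹ y, param (f (φ⁻¹ y), t))` of a fibre product. -/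
noncomputable def fibreParam (c : SubmersionChart IX IM K q) (n₀ : N) (y : EN × K) : N × X :=
  ((extChartAt IN n₀).symm y.1, c.param (f ((extChartAt IN n₀).symm y.1), y.2))

variable (IN) in
def fibreSource (c : SubmersionChart IX IM K q) (n₀ : N) : Set (N × X) :=
  (extChartAt IN n₀).source ×ˢ c.source

variable (IN f) in
def fibreTarget (c : SubmersionChart IX IM K q) (n₀ : N) : Set (EN × K) :=
  {y | y.1 ∈ (extChartAt IN n₀).target ∧ (f ((extChartAt IN n₀).symm y.1), y.2) ∈ c.target}

variable (c : SubmersionChart IX IM K q) (n₀ : N)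

theorem isOpen_fibreSource : IsOpen (c.fibreSource IN n₀) :=
  (isOpen_extChartAt_source n₀).prod c.isOpen_source

theorem contMDiffOn_fibreCoord [IsManifold IN ∞ N] :
    ContMDiffOn (IN.prod IX) 𝓘(ℝ, EN × K) ∞ (c.fibreCoord IN n₀) (c.fibreSource IN n₀) := by
  have hφ : ContMDiffOn IN 𝓘(ℝ, EN) ∞ (extChartAt IN n₀) (extChartAt IN n₀).source := by
    simpa using contMDiffOn_extChartAt (I := IN) (x := n₀) (n := ∞)
  exact (hφ.comp contMDiffOn_fst fun z hz => hz.1).prodMk_space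
    (c.contMDiffOn_coord.comp contMDiffOn_snd fun z hz => hz.2)

theorem contMDiffOn_extChartAt_symm_fst [IsManifold IN ∞ N] :
    ContMDiffOn 𝓘(ℝ, EN × K) IN ∞ (fun y : EN × K => (extChartAt IN n₀).symm y.1)
      {y | y.1 ∈ (extChartAt IN n₀).target} :=
  (contMDiffOn_extChartAt_symm n₀).comp contDiff_fst.contMDiff.contMDiffOn fun _ hy => hy

theorem contMDiffOn_left_extChartAt_symm [IsManifold IN ∞ N] (hf : ContMDiff IN IM ∞ f) :
    ContMDiffOn 𝓘(ℝ, EN × K) (IM.prod 𝓘(ℝ, K)) ∞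
      (fun y : EN × K => (f ((extChartAt IN n₀).symm y.1), y.2))
      {y | y.1 ∈ (extChartAt IN n₀).target} :=
  (hf.comp_contMDiffOn (contMDiffOn_extChartAt_symm_fst n₀)).prodMk
    contDiff_snd.contMDiff.contMDiffOn

theorem isOpen_fibreTarget [IN.Boundaryless] [IsManifold IN ∞ N] (hf : ContMDiff IN IM ∞ f) :
    IsOpen (c.fibreTarget IN f n₀) :=
  (contMDiffOn_left_extChartAt_symm n₀ hf).continuousOn.isOpen_inter_preimage
    ((isOpen_extChartAt_target n₀).preimage continuous_fst) c.isOpen_target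

theorem contMDiffOn_fibreParam [IsManifold IN ∞ N] (hf : ContMDiff IN IM ∞ f) :
    ContMDiffOn 𝓘(ℝ, EN × K) (IN.prod IX) ∞ (c.fibreParam IN f n₀) (c.fibreTarget IN f n₀) :=
  ((contMDiffOn_extChartAt_symm_fst n₀).mono fun _ hy => hy.1).prodMk
    (c.contMDiffOn_param.comp ((contMDiffOn_left_extChartAt_symm n₀ hf).mono fun _ hy => hy.1)
      fun _ hy => hy.2)

theorem fibreParam_mem {y : EN × K} (hy : y ∈ c.fibreTarget IN f n₀) :
    f (c.fibreParam IN f n₀ y).1 = q (c.fibreParam IN f n₀ y).2 :=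
  (c.apply_param _ hy.2).symm

open Classical in
/-- The chart of a fibre product given by a chart of the base and a local form of the
submersion. -/
noncomputable def fibreProductChart [IN.Boundaryless] [IsManifold IN ∞ N]
    (hf : ContMDiff IN IM ∞ f) (p₀ : FibreProduct f q) :
    OpenPartialHomeomorph (FibreProduct f q) (EN × K) where
  toFun p := c.fibreCoord IN n₀ p.1
  -- The point `p₀` is only a default value off the target.
  invFun y := if h : y ∈ c.fibreTarget IN f n₀ then ⟨c.fibreParam IN f n₀ y, c.fibreParam_mem n₀ h⟩
    else p₀
  source := Subtype.val ⁻¹' c.fibreSource IN n₀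
  target := c.fibreTarget IN f n₀
  map_source' := by
    rintro ⟨⟨n, x⟩, h⟩ ⟨hn, hx⟩
    refine ⟨(extChartAt IN n₀).map_source hn, ?_⟩
    simp only [fibreCoord, (extChartAt IN n₀).left_inv hn]
    simp only at h
    rw [h]
    exact c.map_source x hx
  map_target' := by
    intro y hy
    rw [dif_pos hy]
    exact ⟨(extChartAt IN n₀).map_target hy.1, c.map_target _ hy.2⟩
  left_inv' := by
    rintro ⟨⟨n, x⟩, h⟩ ⟨hn, hx⟩
    simp only at h hn hx
    have hm : c.fibreCoord IN n₀ (n, x) ∈ c.fibreTarget IN f n₀ := by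
      refine ⟨(extChartAt IN n₀).map_source hn, ?_⟩
      simp only [fibreCoord, (extChartAt IN n₀).left_inv hn, h]
      exact c.map_source x hx
    rw [dif_pos hm]
    refine Subtype.ext ?_
    simp only [fibreParam, fibreCoord, (extChartAt IN n₀).left_inv hn, h, c.left_inv x hx]
  right_inv' := by
    intro y hy
    simp only [dif_pos hy, fibreCoord, fibreParam, (extChartAt IN n₀).right_inv hy.1,
      c.coord_param _ hy.2]
  open_source := (c.isOpen_fibreSource n₀).preimage continuous_subtype_val
  open_target := c.isOpen_fibreTarget n₀ hf
  continuousOn_toFun := (c.contMDiffOn_fibreCoord n₀).continuousOn.comp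
    continuous_subtype_val.continuousOn fun _ hp => hp
  continuousOn_invFun := by
    refine IsInducing.subtypeVal.continuousOn_iff.2 ?_
    refine (c.contMDiffOn_fibreParam n₀ hf).continuousOn.congr fun y hy => ?_
    simp only [Function.comp, dif_pos hy]

theorem coe_fibreProductChart_symm [IN.Boundaryless] [IsManifold IN ∞ N]
    (hf : ContMDiff IN IM ∞ f) (p₀ : FibreProduct f q) {y : EN × K}
    (hy : y ∈ c.fibreTarget IN f n₀) :
    ((c.fibreProductChart n₀ hf p₀).symm y : N × X) = c.fibreParam IN f n₀ y :=
  congrArg Subtype.val (dif_pos hy)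

end SubmersionChart

section

variable [IN.Boundaryless] [IsManifold IN ∞ N] (hf : ContMDiff IN IM ∞ f)
  (c : X → SubmersionChart IX IM K q) (hc : ∀ x, x ∈ (c x).source)

/-- The atlas of a fibre product given by a family of local forms of the submersion. -/
@[reducible] noncomputable def FibreProduct.chartedSpace :
    ChartedSpace (EN × K) (FibreProduct f q) where
  atlas := Set.range fun p : FibreProduct f q => (c p.1.2).fibreProductChart p.1.1 hf p
  chartAt p := (c p.1.2).fibreProductChart p.1.1 hf p
  mem_chart_source p := ⟨mem_extChartAt_source p.1.1, hc p.1.2⟩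
  chart_mem_atlas p := ⟨p, rfl⟩

/-- A transition map is `fibreParam` of one chart followed by `fibreCoord` of another. Both are
smooth maps between open parts of `EN × K` and of the ambient `N × X`. -/
theorem FibreProduct.isManifold :
    letI := FibreProduct.chartedSpace hf c hc
    IsManifold 𝓘(ℝ, EN × K) ∞ (FibreProduct f q) := by
  let := FibreProduct.chartedSpace hf c hc
  refine isManifold_of_contDiffOn _ _ _ ?_
  rintro _ _ ⟨p, rfl⟩ ⟨p', rfl⟩
  rw [← contMDiffOn_iff_contDiffOn]
  have h1 := ((c p.1.2).contMDiffOn_fibreParam (IN := IN) p.1.1 hf)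
  have h2 := (c p'.1.2).contMDiffOn_fibreCoord (IN := IN) p'.1.1
  have hval := fun y hy => (c p.1.2).coe_fibreProductChart_symm (y := y) p.1.1 hf p hy
  refine ContMDiffOn.congr (h2.comp (t := ((c p'.1.2).fibreSource IN p'.1.1))
    (s := {y | y ∈ (c p.1.2).fibreTarget IN f p.1.1 ∧
      (c p.1.2).fibreParam IN f p.1.1 y ∈ (c p'.1.2).fibreSource IN p'.1.1})
    (h1.mono fun y hy => hy.1) fun y hy => hy.2) ?_ |>.mono ?_
  · rintro y ⟨hy, -⟩
    change (c p'.1.2).fibreCoord IN p'.1.1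
      ((((c p.1.2).fibreProductChart p.1.1 hf p).symm y : FibreProduct f q) : N × X) = _
    rw [hval y hy]
    rfl
  · rintro y ⟨⟨hy, hy'⟩, -⟩
    refine ⟨hy, ?_⟩
    change ((((c p.1.2).fibreProductChart p.1.1 hf p).symm y : FibreProduct f q) : N × X) ∈
      (c p'.1.2).fibreSource IN p'.1.1 at hy'
    rwa [hval y hy] at hy'

theorem FibreProduct.contMDiff_val :
    letI := FibreProduct.chartedSpace hf c hc
    ContMDiff 𝓘(ℝ, EN × K) (IN.prod IX) ∞ (Subtype.val : FibreProduct f q → N × X) := by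
  let := FibreProduct.chartedSpace hf c hc
  have := FibreProduct.isManifold hf c hc
  intro p
  have h1 : ContMDiffAt 𝓘(ℝ, EN × K) 𝓘(ℝ, EN × K) ∞ (chartAt (EN × K) p) p :=
    contMDiffAt_of_mem_maximalAtlas (IsManifold.chart_mem_maximalAtlas p)
      (mem_chart_source _ p)
  have h2 := (((c p.1.2).contMDiffOn_fibreParam (IN := IN) p.1.1 hf).contMDiffAt
    (((c p.1.2).isOpen_fibreTarget p.1.1 hf).mem_nhds
      ((chartAt (EN × K) p).map_source (mem_chart_source _ p)))).comp p h1
  refine h2.congr_of_eventuallyEq ?_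
  filter_upwards [(chartAt (EN × K) p).open_source.mem_nhds (mem_chart_source _ p)] with y hy
  have h3 := (c p.1.2).coe_fibreProductChart_symm p.1.1 hf p
    ((chartAt (EN × K) p).map_source hy)
  rw [← Function.comp_apply (f := (c p.1.2).fibreParam IN f p.1.1)] at h3
  refine Eq.trans ?_ h3
  exact congrArg Subtype.val ((chartAt (EN × K) p).left_inv hy).symm

theorem FibreProduct.isTransversePullback [FiniteDimensional ℝ EX] [FiniteDimensional ℝ EM]
    [FiniteDimensional ℝ EN] [FiniteDimensional ℝ K]
    (hK : Module.finrank ℝ K = Module.finrank ℝ EX - Module.finrank ℝ EM)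
    (hq : ContMDiff IX IM ∞ q) (hs : ∀ x, Function.Surjective (mfderiv IX IM q x)) :
    letI := FibreProduct.chartedSpace hf c hc
    IsTransversePullback 𝓘(ℝ, EN × K) IN IX IM
      (fun p : FibreProduct f q => p.1.1) (fun p => p.1.2) f q := by
  let := FibreProduct.chartedSpace hf c hc
  have := FibreProduct.isManifold hf c hc
  have hval := FibreProduct.contMDiff_val hf c hc
  refine ⟨contMDiff_fst.comp hval, contMDiff_snd.comp hval, hf, hq, fun p => p.2,
    fun n x h => ⟨⟨(n, x), h⟩, rfl, rfl⟩, hs, ?_, ?_⟩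
  -- A point of the fibre product yields `dim M ≤ dim X`, so the subtraction in `hK` is not
  -- truncated.
  · rintro ⟨p⟩
    have h : Module.finrank ℝ EM ≤ Module.finrank ℝ EX :=
      LinearMap.finrank_le_finrank_of_surjective
        (f := (mfderiv IX IM q p.1.2 : EX →L[ℝ] EM).toLinearMap) (hs p.1.2)
    rw [Module.finrank_prod]
    omega
  · intro p
    let e := chartAt (EN × K) p
    have hco := (c p.1.2).contMDiffOn_fibreCoord (IN := IN) p.1.1
    have hso := (c p.1.2).isOpen_fibreSource (IN := IN) p.1.1
    have hps : p ∈ e.source := mem_chart_source _ p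
    -- The formula for the chart makes sense on an open subset of `N × X`; following it by the
    -- inverse chart gives the retraction.
    refine ⟨fun z => e.symm ((c p.1.2).fibreCoord IN p.1.1 z),
      (c p.1.2).fibreSource IN p.1.1 ∩ (c p.1.2).fibreCoord IN p.1.1 ⁻¹' e.target,
      hco.continuousOn.isOpen_inter_preimage hso e.open_target,
      ⟨hps, e.map_source hps⟩, ?_, ?_⟩
    · exact (contMDiffOn_symm_of_mem_maximalAtlas
        (IsManifold.chart_mem_maximalAtlas p)).comp
        (hco.mono Set.inter_subset_left) fun z hz => hz.2
    · intro y hy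
      exact e.left_inv hy.1

end

end

/-! ### Lifting tangent vectors by partitions of unity -/

section

open Bundle Filter Topology

variable {EP HP P EX HX X EM HM M : Type*}
  [NormedAddCommGroup EP] [NormedSpace ℝ EP] [TopologicalSpace HP] [TopologicalSpace P]
  [ChartedSpace HP P] {IP : ModelWithCorners ℝ EP HP}
  [NormedAddCommGroup EX] [NormedSpace ℝ EX] [TopologicalSpace HX] [TopologicalSpace X]
  [ChartedSpace HX X] {IX : ModelWithCorners ℝ EX HX}
  [NormedAddCommGroup EM] [NormedSpace ℝ EM] [TopologicalSpace HM] [TopologicalSpace M]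
  [ChartedSpace HM M] {IM : ModelWithCorners ℝ EM HM}

instance Bundle.Pullback.addCommGroup {B B' : Type*} (V : B → Type*) (b : B' → B)
    [∀ x, AddCommGroup (V x)] (p : B') : AddCommGroup ((b *ᵖ V) p) :=
  inferInstanceAs (AddCommGroup (V (b p)))

/-- Sections of `b *ᵖ TX` are maps to `TX` over `b`. Through this dictionary the gluing theorem for
bundle sections produces the lift below. -/
theorem contMDiffWithinAt_pullback_iff [IsManifold IX ∞ X] (b : C^∞⟮IP, P; IX, X⟯)
    (s : ∀ p, (b *ᵖ (TangentSpace IX : X → Type _)) p) {U : Set P} {p : P} :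
    ContMDiffWithinAt IP (IP.prod 𝓘(ℝ, EX)) ∞
      (fun p => (⟨p, s p⟩ : TotalSpace EX (b *ᵖ (TangentSpace IX : X → Type _)))) U p ↔
    ContMDiffWithinAt IP IX.tangent ∞ (fun p => (⟨b p, s p⟩ : TangentBundle IX X)) U p := by
  rw [contMDiffWithinAt_totalSpace, contMDiffWithinAt_totalSpace]
  refine and_congr ?_ Iff.rfl
  exact ⟨fun _ => b.contMDiff.contMDiffAt.contMDiffWithinAt, fun _ => contMDiffWithinAt_id⟩

theorem contMDiff_zero_tangentBundle {K : Type*} [NormedAddCommGroup K] [NormedSpace ℝ K] :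
    ContMDiff 𝓘(ℝ, K) 𝓘(ℝ, K).tangent ∞ (fun k : K => (⟨k, 0⟩ : TangentBundle 𝓘(ℝ, K) K)) :=
  contMDiff_zeroSection ℝ (TangentSpace 𝓘(ℝ, K) : K → Type _)

/-- Tangent vectors can be lifted along a submersion, smoothly in parameters. -/
theorem exists_contMDiff_tangent_lift [FiniteDimensional ℝ EP] [FiniteDimensional ℝ EX]
    [FiniteDimensional ℝ EM] [IX.Boundaryless] [IM.Boundaryless]
    [IsManifold IP ∞ P] [IsManifold IX ∞ X] [IsManifold IM ∞ M] [T2Space P] [SigmaCompactSpace P]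
    {q : X → M} (hq : ContMDiff IX IM ∞ q) (hs : ∀ x, Function.Surjective (mfderiv IX IM q x))
    {a : P → TangentBundle IM M} {b : P → X} (ha : ContMDiff IP IM.tangent ∞ a)
    (hb : ContMDiff IP IX ∞ b) (hab : ∀ p, (a p).proj = q (b p)) :
    ∃ l : P → TangentBundle IX X, ContMDiff IP IX.tangent ∞ l ∧
      (∀ p, tangentMap IX IM q (l p) = a p) ∧ ∀ p, (l p).proj = b p := by
  let b' : C^∞⟮IP, P; IX, X⟯ := ⟨b, hb⟩
  have hqd : MDifferentiable IX IM q := hq.mdifferentiable (by simp)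
  -- The admissible lifts over `p` form an affine subspace, hence a convex set, so local smooth
  -- lifts can be averaged.
  let t (p : P) : Set ((b' *ᵖ (TangentSpace IX : X → Type _)) p) :=
    {v | tangentMap IX IM q (⟨b p, v⟩ : TangentBundle IX X) = a p}
  have ht : ∀ p v, v ∈ t p ↔
      (mfderiv IX IM q (b p) : EX →L[ℝ] EM) v = ((a p).2 : EM) := by
    intro p v
    refine ⟨fun h => ?_, fun h => TotalSpace.ext (hab p).symm (heq_of_eq h)⟩
    have h' : tangentMap IX IM q (⟨b p, v⟩ : TangentBundle IX X) = a p := h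
    rw [← h']
    rfl
  have htc : ∀ p, Convex ℝ (t p) := by
    intro p
    have h : Convex ℝ ((mfderiv IX IM q (b p) : EX →L[ℝ] EM).toLinearMap ⁻¹' {((a p).2 : EM)}) :=
      (convex_singleton _).linear_preimage _
    exact (Set.ext (ht p) : t p = _) ▸ h
  obtain ⟨s, hst⟩ := exists_contMDiffSection_forall_mem_convex_of_local (n := ⊤) (F_fiber := EX) IP
    (b' *ᵖ (TangentSpace IX : X → Type _)) t htc (by
      intro p₀
      obtain ⟨c, hc⟩ := exists_submersionChart
        (K := EuclideanSpace ℝ (Fin (Module.finrank ℝ EX - Module.finrank ℝ EM))) (by simp) hq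
        (hs (b p₀))
      have hU : IsOpen (b ⁻¹' c.source) := c.isOpen_source.preimage hb.continuous
      -- In the local form of `q`, lift `a p` with zero component in the fibre direction.
      let g : P → TangentBundle IX X := fun p => c.tangentParam (a p, ⟨c.coord (b p), 0⟩)
      have hmem : ∀ p ∈ b ⁻¹' c.source, ((a p).proj, c.coord (b p)) ∈ c.target := by
        intro p hp
        rw [hab]
        exact c.map_source _ hp
      have hg : ContMDiffOn IP IX.tangent ∞ g (b ⁻¹' c.source) :=
        c.contMDiffOn_tangentParam.comp (ha.contMDiffOn.prodMk
          (contMDiff_zero_tangentBundle.comp_contMDiffOn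
            (c.contMDiffOn_coord.comp hb.contMDiffOn fun _ hp => hp))) hmem
      have hgb : ∀ p ∈ b ⁻¹' c.source, (g p).proj = b p := by
        intro p hp
        change c.param ((a p).proj, c.coord (b p)) = b p
        rw [hab]
        exact c.left_inv _ hp
      have hgs : ∀ p ∈ b ⁻¹' c.source, (⟨b p, (g p).2⟩ : TangentBundle IX X) = g p := by
        intro p hp
        exact TotalSpace.ext (hgb p hp).symm HEq.rfl
      refine ⟨b ⁻¹' c.source, hU.mem_nhds hc, fun p => (g p).2, fun p hp => ?_, fun p hp => ?_⟩
      · exact (contMDiffWithinAt_pullback_iff b' _).2 ((hg p hp).congr hgs (hgs p hp))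
      · change tangentMap IX IM q (⟨b p, (g p).2⟩ : TangentBundle IX X) = a p
        rw [hgs p hp]
        exact c.tangentMap_tangentParam hqd _ (hmem p hp))
  refine ⟨fun p => ⟨b p, s p⟩, fun p => ?_, hst, fun p => rfl⟩
  exact (contMDiffWithinAt_pullback_iff b' _).1 (s.contMDiff p)

end

/-! ### A curve through one point with two different velocities -/

/-- In a chart the curve moves along a line with displacement `ε (sin 2t - 2 sin t)`. This vanishes
at `0` and `π`, while its derivative `ε (2 cos 2t - 2 cos t)` is `0` at `0` and `4ε` at `π`. Being
bounded, it stays in the chart for small `ε`, so the curve is defined on all of `ℝ`. -/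
theorem exists_contMDiff_curve {E H M : Type*} [NormedAddCommGroup E] [NormedSpace ℝ E]
    [TopologicalSpace H] [TopologicalSpace M] [ChartedSpace H M] (I : ModelWithCorners ℝ E H)
    [I.Boundaryless] [IsManifold I ∞ M] (y : M) (u : E) :
    ∃ γ : ℝ → M, ContMDiff 𝓘(ℝ, ℝ) I ∞ γ ∧ γ 0 = y ∧ γ Real.pi = y ∧
      (∀ s : ℝ, (mfderiv 𝓘(ℝ, ℝ) I γ 0 s : E) = 0) ∧
      ∃ c : ℝ, c ≠ 0 ∧ ∀ s : ℝ, (mfderiv 𝓘(ℝ, ℝ) I γ Real.pi s : E) = (s * c) • u := by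
  let φ := extChartAt I y
  have hφo : φ.target ∈ nhds (φ y) := extChartAt_target_mem_nhds y
  have hφs : ContMDiffOn 𝓘(ℝ, E) I ∞ φ.symm φ.target := contMDiffOn_extChartAt_symm y
  have hinv : φ.symm (φ y) = y := extChartAt_to_inv y
  have hd : MDifferentiableAt 𝓘(ℝ, E) I φ.symm (φ y) :=
    (hφs.contMDiffAt hφo).mdifferentiableAt (by simp)
  have hsurj : Function.Surjective (mfderiv 𝓘(ℝ, E) I φ.symm (φ y)) := by
    refine surjective_mfderiv_of_local_section (σ := φ) hd ?_ (by rw [hinv]) ?_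
    · rw [hinv]
      exact (contMDiffAt_extChartAt (n := ∞)).mdifferentiableAt (by simp)
    · rw [hinv]
      filter_upwards [extChartAt_source_mem_nhds (I := I) y] with z hz using φ.left_inv hz
  obtain ⟨w, hw⟩ : ∃ w : E, (mfderiv 𝓘(ℝ, E) I φ.symm (φ y) w : E) = u := hsurj u
  obtain ⟨δ, hδ, hball⟩ := Metric.mem_nhds_iff.1 hφo
  -- The displacement factor is at most `3` in absolute value, so `3 ε ‖w‖ < δ` is what is needed;
  -- the `+ 1` allows `w = 0`.
  let ε := δ / (4 * (‖w‖ + 1))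
  have hε : 0 < ε := by positivity
  let h : ℝ → E := fun t => φ y + (ε * (Real.sin (2 * t) - 2 * Real.sin t)) • w
  have hh : ContDiff ℝ ∞ h := by
    have : ContDiff ℝ ∞ fun t : ℝ => ε * (Real.sin (2 * t) - 2 * Real.sin t) := by fun_prop
    exact contDiff_const.add (this.smul contDiff_const)
  have hht : ∀ t, h t ∈ φ.target := by
    intro t
    apply hball
    rw [mem_ball_iff_norm, add_sub_cancel_left, norm_smul, Real.norm_eq_abs, abs_mul,
      abs_of_pos hε]
    have h1 : |Real.sin (2 * t) - 2 * Real.sin t| ≤ 3 := by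
      rw [abs_le]
      constructor <;>
      linarith [Real.sin_le_one (2 * t), Real.neg_one_le_sin (2 * t), Real.sin_le_one t,
        Real.neg_one_le_sin t]
    have h2 : ε * (4 * (‖w‖ + 1)) = δ := by
      have : (4 * (‖w‖ + 1)) ≠ 0 := by positivity
      simp only [ε]
      field_simp
    have h3 : ε * |Real.sin (2 * t) - 2 * Real.sin t| ≤ ε * 3 := by gcongr
    nlinarith [norm_nonneg w, mul_le_mul_of_nonneg_right h3 (norm_nonneg w),
      mul_nonneg hε.le (norm_nonneg w)]
  have hderiv : ∀ t, HasDerivAt h ((ε * (2 * Real.cos (2 * t) - 2 * Real.cos t)) • w) t := by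
    intro t
    have h1 : HasDerivAt (fun t : ℝ => Real.sin (2 * t)) (Real.cos (2 * t) * 2) t := by
      simpa using ((hasDerivAt_id t).const_mul 2).sin
    have h2 := ((h1.sub ((Real.hasDerivAt_sin t).const_mul 2)).const_mul ε).smul_const w
    have h3 := h2.const_add (φ y)
    convert! h3 using 3
    ring
  have hmf : ∀ t, h t = φ y → ∀ s : ℝ, (mfderiv 𝓘(ℝ, ℝ) I (φ.symm ∘ h) t s : E) =
      (s * (ε * (2 * Real.cos (2 * t) - 2 * Real.cos t))) • u := by
    intro t ht s
    have hdt : MDifferentiableAt 𝓘(ℝ, E) I φ.symm (h t) := by rwa [ht]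
    have h1 := mfderiv_comp t hdt (hh.contMDiff.mdifferentiable (by simp) t)
    have h2 : (mfderiv 𝓘(ℝ, ℝ) I (φ.symm ∘ h) t s : E) =
        mfderiv 𝓘(ℝ, E) I φ.symm (h t) (mfderiv 𝓘(ℝ, ℝ) 𝓘(ℝ, E) h t s) := congrArg (· s) h1
    rw [h2, mfderiv_eq_fderiv, ht]
    have h3 : (fderiv ℝ h t s : E) =
        (s * (ε * (2 * Real.cos (2 * t) - 2 * Real.cos t))) • w := by
      rw [(hderiv t).hasFDerivAt.fderiv]
      simp [mul_smul]
    let D : E →L[ℝ] E := mfderiv 𝓘(ℝ, E) I φ.symm (φ y)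
    change D (fderiv ℝ h t s) = _
    rw [h3, map_smul]
    exact congrArg _ hw
  have h0 : h 0 = φ y := by simp [h]
  have hpi : h Real.pi = φ y := by simp [h]
  refine ⟨φ.symm ∘ h, fun t => ?_, ?_, ?_, ?_, ε * 4, by positivity, ?_⟩
  · exact (hφs.comp_contMDiff hh.contMDiff hht) t
  · rw [Function.comp_apply, h0, hinv]
  · rw [Function.comp_apply, hpi, hinv]
  · intro s
    have h1 : (s * (ε * (2 * Real.cos (2 * 0) - 2 * Real.cos 0))) • u = 0 := by simp
    exact (hmf 0 h0 s).trans h1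
  · intro s
    have h1 : (s * (ε * (2 * Real.cos (2 * Real.pi) - 2 * Real.cos Real.pi))) • u =
        (s * (ε * 4)) • u := by
      rw [Real.cos_two_pi, Real.cos_pi]
      norm_num
    exact (hmf _ hpi s).trans h1

/-! ### Formal properties of weak pullbacks and `T`-pullbacks -/

namespace TangentCat

universe v u

variable {C : Type u} [Category.{v} C]

theorem IsWeakPullback.exists_lift {P X Y Z W : C} {fst : P ⟶ X} {snd : P ⟶ Y} {f : X ⟶ Z}
    {g : Y ⟶ Z} (h : IsWeakPullback fst snd f g) (a : W ⟶ X) (b : W ⟶ Y) (w : a ≫ f = b ≫ g) :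
    ∃ l : W ⟶ P, l ≫ fst = a ∧ l ≫ snd = b := by
  obtain ⟨hl⟩ := h.isWeakLimit'
  exact ⟨hl.lift (PullbackCone.mk a b w), hl.fac (PullbackCone.mk a b w) WalkingCospan.left,
    hl.fac (PullbackCone.mk a b w) WalkingCospan.right⟩

/-- A square whose comparison map to a pullback has a section is a weak pullback. -/
theorem IsWeakPullback.of_section {P Q X Y Z : C} {π₁ : P ⟶ X} {π₂ : P ⟶ Y} {fst : Q ⟶ X}
    {snd : Q ⟶ Y} {f : X ⟶ Z} {g : Y ⟶ Z} (h : IsPullback π₁ π₂ f g) (w : fst ≫ f = snd ≫ g)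
    (σ : P ⟶ Q) (h₁ : σ ≫ fst = π₁) (h₂ : σ ≫ snd = π₂) : IsWeakPullback fst snd f g where
  w := w
  isWeakLimit' := ⟨PullbackCone.IsWeakLimit.mk w (fun s => h.lift s.fst s.snd s.condition ≫ σ)
    (fun s => by rw [Category.assoc, h₁, h.lift_fst])
    (fun s => by rw [Category.assoc, h₂, h.lift_snd])⟩

theorem IsTPullback.map_iter {T : C ⥤ C} {P X Y Z : C} {fst : P ⟶ X} {snd : P ⟶ Y} {f : X ⟶ Z}
    {g : Y ⟶ Z} (h : IsTPullback T fst snd f g) (n : ℕ) :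
    IsPullback ((iter T n).map fst) ((iter T n).map snd) ((iter T n).map f)
      ((iter T n).map g) := by
  rcases n.eq_zero_or_pos with rfl | hn
  · exact h.1
  · exact h.2 n hn

/-- Pullbacks of one cospan are isomorphic and `Tⁿ` preserves isomorphisms, so exhibiting a single
`T`-pullback is enough. -/
theorem IsTPullback.of_isPullback {T : C ⥤ C} {P Q X Y Z : C} {fst : P ⟶ X} {snd : P ⟶ Y}
    {fst' : Q ⟶ X} {snd' : Q ⟶ Y} {f : X ⟶ Z} {g : Y ⟶ Z} (h : IsTPullback T fst snd f g)
    (h' : IsPullback fst' snd' f g) : IsTPullback T fst' snd' f g := by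
  refine ⟨h', fun n _ => ?_⟩
  let e := h'.isoIsPullback _ _ h.1
  have he₁ : e.hom ≫ fst = fst' := h'.isoIsPullback_hom_fst _ _ h.1
  have he₂ : e.hom ≫ snd = snd' := h'.isoIsPullback_hom_snd _ _ h.1
  refine (h.map_iter n).of_iso ((iter T n).mapIso e.symm) (Iso.refl _) (Iso.refl _) (Iso.refl _)
    ?_ ?_ (by simp) (by simp)
  · rw [← he₁]
    simp [← Functor.map_comp]
  · rw [← he₂]
    simp [← Functor.map_comp]

end TangentCat

/-! ### Usual submersions are display submersions -/

namespace Smooth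

open TangentCat

/-- The morphism given by a smooth map. -/
def ofContMDiff {M N : Smooth} (f : M → N) (hf : ContMDiff M.I N.I ∞ f) : M ⟶ N :=
  (⟨f, hf⟩ : C^∞⟮M.I, M; N.I, N⟯)

theorem contMDiff_toMap {M N : Smooth} (f : M ⟶ N) : ContMDiff M.I N.I ∞ (toMap f) :=
  (toMap f).contMDiff

theorem hom_ext_apply {M N : Smooth} {f g : M ⟶ N} (h : ∀ x, toMap f x = toMap g x) : f = g :=
  ContMDiffMap.coe_injective (funext h)

/-- The zero-dimensional one-point manifold. -/
noncomputable def point : Smooth where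
  carrier := EuclideanSpace ℝ (Fin 0)
  E := EuclideanSpace ℝ (Fin 0)
  H := EuclideanSpace ℝ (Fin 0)
  I := 𝓘(ℝ, EuclideanSpace ℝ (Fin 0))

/-- The real line as a manifold. -/
noncomputable def line : Smooth where
  carrier := ℝ
  E := ℝ
  H := ℝ
  I := 𝓘(ℝ, ℝ)

def pointPt : point := (0 : EuclideanSpace ℝ (Fin 0))

/-- The inclusion of a point. -/
noncomputable def const {M : Smooth} (x : M) : point ⟶ M :=
  ofContMDiff (fun _ => x) contMDiff_const

section Points

variable {P N E M : Smooth} {π₁ : P ⟶ N} {π₂ : P ⟶ E} {f : N ⟶ M} {q : E ⟶ M}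

theorem comm_apply (w : π₁ ≫ f = π₂ ≫ q) (p : P) :
    toMap f (toMap π₁ p) = toMap q (toMap π₂ p) :=
  congrArg (fun g => toMap g p) w

/-- Points are morphisms from the one-point manifold, so the universal property can be tested on
them. -/
theorem exists_of_isWeakPullback (h : IsWeakPullback π₁ π₂ f q) {n : N} {x : E}
    (hnx : toMap f n = toMap q x) : ∃ p, toMap π₁ p = n ∧ toMap π₂ p = x := by
  obtain ⟨l, h₁, h₂⟩ := h.exists_lift (const n) (const x) (hom_ext_apply fun _ => hnx)
  exact ⟨toMap l pointPt, congrArg (fun g => toMap g pointPt) h₁,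
    congrArg (fun g => toMap g pointPt) h₂⟩

theorem exists_of_isPullback (h : IsPullback π₁ π₂ f q) {n : N} {x : E}
    (hnx : toMap f n = toMap q x) : ∃ p, toMap π₁ p = n ∧ toMap π₂ p = x :=
  exists_of_isWeakPullback (.of_section h h.w (𝟙 P) (Category.id_comp _) (Category.id_comp _)) hnx

theorem injective_of_isPullback (h : IsPullback π₁ π₂ f q) {p p' : P}
    (h₁ : toMap π₁ p = toMap π₁ p') (h₂ : toMap π₂ p = toMap π₂ p') : p = p' := by
  have := h.hom_ext (k := const p) (l := const p') (hom_ext_apply fun _ => h₁)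
    (hom_ext_apply fun _ => h₂)
  exact congrArg (fun g => toMap g pointPt) this

end Points

section Transverse

/-- The square is a transverse pullback of manifolds. -/
abbrev IsTransverse {P N E M : Smooth} (π₁ : P ⟶ N) (π₂ : P ⟶ E) (f : N ⟶ M) (q : E ⟶ M) : Prop :=
  IsTransversePullback P.I N.I E.I M.I (toMap π₁) (toMap π₂) (toMap f) (toMap q)

variable {P N E M : Smooth} {π₁ : P ⟶ N} {π₂ : P ⟶ E} {f : N ⟶ M} {q : E ⟶ M}

theorem IsTransverse.isPullback (h : IsTransverse π₁ π₂ f q) : IsPullback π₁ π₂ f q where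
  w := hom_ext_apply h.comm
  isLimit' := by
    have hl : ∀ s : PullbackCone f q, ∃ l : s.pt ⟶ P, l ≫ π₁ = s.fst ∧ l ≫ π₂ = s.snd := by
      intro s
      obtain ⟨l, hl, h₁, h₂⟩ := h.exists_lift (contMDiff_toMap s.fst) (contMDiff_toMap s.snd)
        (comm_apply s.condition)
      exact ⟨ofContMDiff l hl, hom_ext_apply h₁, hom_ext_apply h₂⟩
    choose l h₁ h₂ using hl
    refine ⟨PullbackCone.IsLimit.mk _ l h₁ h₂ fun s m hm₁ hm₂ => hom_ext_apply fun z => ?_⟩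
    refine h.injective ?_ ?_
    · exact congrArg (fun g => toMap g z) (hm₁.trans (h₁ s).symm)
    · exact congrArg (fun g => toMap g z) (hm₂.trans (h₂ s).symm)

theorem IsTransverse.map (h : IsTransverse π₁ π₂ f q) :
    IsTransverse (T.map π₁) (T.map π₂) (T.map f) (T.map q) :=
  IsTransversePullback.tangent h

theorem IsTransverse.map_iter (h : IsTransverse π₁ π₂ f q) (n : ℕ) :
    IsTransverse ((iter T n).map π₁) ((iter T n).map π₂) ((iter T n).map f)
      ((iter T n).map q) := by
  -- `iter T (n + 1)` applies `T` first, so the induction hypothesis is needed for the tangent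
  -- square.
  induction n generalizing P N E M with
  | zero => exact h
  | succ n ih => exact ih h.map

theorem IsTransverse.isTPullback (h : IsTransverse π₁ π₂ f q) : IsTPullback T π₁ π₂ f q :=
  ⟨h.isPullback, fun n _ => (h.map_iter n).isPullback⟩

theorem IsUsualSubmersion.exists_isTransverse (hq : IsUsualSubmersion q) (f : N ⟶ M) :
    ∃ (P : Smooth) (π₁ : P ⟶ N) (π₂ : P ⟶ E), IsTransverse π₁ π₂ f q := by
  choose c hc using fun x => exists_submersionChart
    (K := EuclideanSpace ℝ (Fin (Module.finrank ℝ E.E - Module.finrank ℝ M.E))) (by simp)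
    (contMDiff_toMap q) (hq x)
  let := FibreProduct.chartedSpace (contMDiff_toMap f) c hc
  have := FibreProduct.isManifold (contMDiff_toMap f) c hc
  have h := FibreProduct.isTransversePullback (contMDiff_toMap f) c hc (by simp)
    (contMDiff_toMap q) hq
  have : SecondCountableTopology (FibreProduct (toMap f) (toMap q)) :=
    TopologicalSpace.Subtype.secondCountableTopology _
  let P : Smooth :=
    { carrier := FibreProduct (toMap f) (toMap q)
      E := N.E × EuclideanSpace ℝ (Fin (Module.finrank ℝ E.E - Module.finrank ℝ M.E))
      H := N.E × EuclideanSpace ℝ (Fin (Module.finrank ℝ E.E - Module.finrank ℝ M.E))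
      I := 𝓘(ℝ, N.E × EuclideanSpace ℝ (Fin (Module.finrank ℝ E.E - Module.finrank ℝ M.E))) }
  exact ⟨P, ofContMDiff (M := P) _ h.contMDiff_fst, ofContMDiff (M := P) _ h.contMDiff_snd, h⟩

theorem IsUsualSubmersion.map (hq : IsUsualSubmersion q) : IsUsualSubmersion (T.map q) :=
  surjective_mfderiv_tangentMap (contMDiff_toMap q) hq

theorem IsUsualSubmersion.map_iter (hq : IsUsualSubmersion q) (n : ℕ) :
    IsUsualSubmersion ((iter T n).map q) := by
  induction n generalizing E M with
  | zero => exact hq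
  | succ n ih => exact ih hq.map

theorem IsUsualSubmersion.admitsAllTPullbacks (hq : IsUsualSubmersion q) :
    AdmitsAllTPullbacks T q := by
  refine ⟨fun N f => ?_, fun P N π₁ π₂ f h => ?_⟩
  · obtain ⟨P, π₁, π₂, h⟩ := hq.exists_isTransverse f
    exact h.isPullback.hasPullback
  · obtain ⟨P', π₁', π₂', h'⟩ := hq.exists_isTransverse f
    exact h'.isTPullback.of_isPullback h

theorem IsUsualSubmersion.isTDisplayMap (hq : IsUsualSubmersion q) : IsTDisplayMap T q :=
  fun n => (hq.map_iter n).admitsAllTPullbacks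

/-- The smooth lift of tangent vectors is a section `σ` of the comparison map from `TE` to the
pullback `P`. Then `Tⁿ σ` is such a section for the image square, because `Tⁿ` preserves the
transverse pullback `P`. -/
theorem IsUsualSubmersion.isSubmersion (hq : IsUsualSubmersion q) : IsSubmersion p q := by
  obtain ⟨P, π₁, π₂, h⟩ := hq.exists_isTransverse (p.app M)
  have := Manifold.locallyCompact_of_finiteDimensional (M := P) P.I
  obtain ⟨l, hl, h₁, h₂⟩ := exists_contMDiff_tangent_lift (contMDiff_toMap q) hq
    (contMDiff_toMap π₁) (contMDiff_toMap π₂) h.comm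
  let σ : P ⟶ T.obj E := ofContMDiff (N := T.obj E) l hl
  have hσ₁ : σ ≫ T.map q = π₁ := hom_ext_apply h₁
  have hσ₂ : σ ≫ p.app E = π₂ := hom_ext_apply h₂
  have hw : T.map q ≫ p.app M = p.app E ≫ q := p.naturality q
  refine ⟨.of_section h.isPullback hw σ hσ₁ hσ₂, fun n _ => ?_⟩
  refine .of_section (h.map_iter n).isPullback ?_ ((iter T n).map σ) ?_ ?_
  · rw [← Functor.map_comp, hw, Functor.map_comp]
  · rw [← Functor.map_comp, hσ₁]
  · rw [← Functor.map_comp, hσ₂]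

end Transverse

end Smooth

/-! ### Pullback conditions force surjective differentials -/

namespace Smooth

open TangentCat

section Converse

variable {P N E M : Smooth} {π₁ : P ⟶ N} {π₂ : P ⟶ E} {f : N ⟶ M} {q : E ⟶ M}

/-- The pullback property of `TP` gives a tangent vector with the prescribed images; its base point
is `x` because points of `P` are determined by their projections. -/
theorem exists_mfderiv_eq_of_isPullback (h : IsPullback π₁ π₂ f q)
    (hT : IsPullback (T.map π₁) (T.map π₂) (T.map f) (T.map q)) (x : P) {v : N.E} {w : E.E}
    (hvw : (mfderiv N.I M.I (toMap f) (toMap π₁ x) v : M.E) =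
      (mfderiv E.I M.I (toMap q) (toMap π₂ x) w : M.E)) :
    ∃ u : P.E, (mfderiv P.I N.I (toMap π₁) x u : N.E) = v ∧
      (mfderiv P.I E.I (toMap π₂) x u : E.E) = w := by
  obtain ⟨⟨x', u⟩, h₁, h₂⟩ := exists_of_isPullback hT
    (n := (⟨toMap π₁ x, v⟩ : TangentBundle N.I N)) (x := (⟨toMap π₂ x, w⟩ : TangentBundle E.I E))
    (Bundle.TotalSpace.ext (comm_apply h.w x) (heq_of_eq hvw))
  have hx : x' = x := injective_of_isPullback h (congrArg Bundle.TotalSpace.proj h₁)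
    (congrArg Bundle.TotalSpace.proj h₂)
  subst hx
  exact ⟨u, eq_of_heq (Bundle.TotalSpace.mk.inj h₁).2, eq_of_heq (Bundle.TotalSpace.mk.inj h₂).2⟩

/-- The tangent space of `P` at `x` is the kernel of `(v, w) ↦ F v - G w`. The left side does not
depend on `x`, which allows two points of `P` to be compared even if they lie in different
components. -/
theorem finrank_eq_of_isPullback (h : IsPullback π₁ π₂ f q)
    (hT : IsPullback (T.map π₁) (T.map π₂) (T.map f) (T.map q)) {x : P} {n : N} {e : E}
    (hn : toMap π₁ x = n) (he : toMap π₂ x = e) {F : N.E →L[ℝ] M.E} {G : E.E →L[ℝ] M.E}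
    (hF : (mfderiv N.I M.I (toMap f) n : N.E →L[ℝ] M.E) = F)
    (hG : (mfderiv E.I M.I (toMap q) e : E.E →L[ℝ] M.E) = G) :
    Module.finrank ℝ P.E = Module.finrank ℝ (LinearMap.ker (F.coprod (-G)).toLinearMap) := by
  subst hn he hF hG
  let A₁ : P.E →L[ℝ] N.E := mfderiv P.I N.I (toMap π₁) x
  let A₂ : P.E →L[ℝ] E.E := mfderiv P.I E.I (toMap π₂) x
  let F : N.E →L[ℝ] M.E := mfderiv N.I M.I (toMap f) (toMap π₁ x)
  let G : E.E →L[ℝ] M.E := mfderiv E.I M.I (toMap q) (toMap π₂ x)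
  let A : P.E →ₗ[ℝ] N.E × E.E := (A₁.prod A₂).toLinearMap
  have hA : Function.Injective A := by
    intro u u' huu
    have h₁ : A₁ u = A₁ u' := congrArg Prod.fst huu
    have h₂ : A₂ u = A₂ u' := congrArg Prod.snd huu
    have h3 : (⟨x, u⟩ : TangentBundle P.I P) = ⟨x, u'⟩ := injective_of_isPullback hT
      (p := (⟨x, u⟩ : TangentBundle P.I P)) (p' := (⟨x, u'⟩ : TangentBundle P.I P))
      (Bundle.TotalSpace.ext rfl (heq_of_eq h₁)) (Bundle.TotalSpace.ext rfl (heq_of_eq h₂))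
    exact eq_of_heq (Bundle.TotalSpace.mk.inj h3).2
  have hr : LinearMap.range A = LinearMap.ker (F.coprod (-G)).toLinearMap := by
    ext ⟨v, w⟩
    constructor
    · rintro ⟨u, hu⟩
      have h₁ : A₁ u = v := congrArg Prod.fst hu
      have h₂ : A₂ u = w := congrArg Prod.snd hu
      have h3 := comm_apply hT.w (⟨x, u⟩ : TangentBundle P.I P)
      have h4 : F (A₁ u) = G (A₂ u) := eq_of_heq (Bundle.TotalSpace.mk.inj h3).2
      rw [h₁, h₂] at h4
      simp [h4]
    · intro hvw
      have h3 : F v = G w := by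
        simpa [← sub_eq_add_neg, sub_eq_zero] using hvw
      obtain ⟨u, h₁, h₂⟩ := exists_mfderiv_eq_of_isPullback h hT x h3
      exact ⟨u, Prod.ext h₁ h₂⟩
  rw [← hr, LinearMap.finrank_range_of_inj hA]

/-- The curve `γ` is chosen so that the kernels over `(0, a)` and `(π, a)` have different dimensions
when `u` is missed by `d_a q`. -/
theorem isUsualSubmersion_of_admitsAllTPullbacks (hq : AdmitsAllTPullbacks T q) :
    IsUsualSubmersion q := by
  intro a
  by_contra hs
  let G : E.E →L[ℝ] M.E := mfderiv E.I M.I (toMap q) a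
  obtain ⟨u, hu⟩ : ∃ u : M.E, ∀ w, G w ≠ u := by
    by_contra! h
    exact hs h
  obtain ⟨γ, hγ, h0, hpi, hγ0, c, hc, hγpi⟩ := exists_contMDiff_curve M.I (toMap q a) u
  let g : line ⟶ M := ofContMDiff (M := line) γ hγ
  have := hq.1 g
  have h := IsPullback.of_hasPullback g q
  have hT := (hq.2 _ _ g h).2 1 one_pos
  obtain ⟨x₀, hx₀, hx₀'⟩ := exists_of_isPullback h (n := (0 : ℝ)) (x := a) h0
  obtain ⟨x₁, hx₁, hx₁'⟩ := exists_of_isPullback h (n := Real.pi) (x := a) hpi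
  let F₀ : ℝ →L[ℝ] M.E := mfderiv 𝓘(ℝ, ℝ) M.I γ 0
  let F₁ : ℝ →L[ℝ] M.E := mfderiv 𝓘(ℝ, ℝ) M.I γ Real.pi
  have hF₀ : ∀ s, F₀ s = 0 := hγ0
  have hF₁ : ∀ s, F₁ s = (s * c) • u := hγpi
  have e₀ : Module.finrank ℝ (pullback g q).E =
      Module.finrank ℝ (LinearMap.ker (F₀.coprod (-G)).toLinearMap) :=
    finrank_eq_of_isPullback h hT hx₀ hx₀' rfl rfl
  have e₁ : Module.finrank ℝ (pullback g q).E =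
      Module.finrank ℝ (LinearMap.ker (F₁.coprod (-G)).toLinearMap) :=
    finrank_eq_of_isPullback h hT hx₁ hx₁' rfl rfl
  -- Over `π`, a kernel vector with `s ≠ 0` would put `u` in the range of `G`.
  have hker : ∀ z : ℝ × E.E, z ∈ LinearMap.ker (F₁.coprod (-G)).toLinearMap → z.1 = 0 := by
    rintro ⟨s, w⟩ hz
    have h1 : (s * c) • u = G w := by
      simpa [← sub_eq_add_neg, sub_eq_zero, hF₁] using hz
    by_contra hs0
    have hsc : s * c ≠ 0 := mul_ne_zero hs0 hc
    apply hu ((s * c)⁻¹ • w)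
    rw [map_smul, ← h1, smul_smul, inv_mul_cancel₀ hsc, one_smul]
  have hle : LinearMap.ker (F₁.coprod (-G)).toLinearMap ≤
      LinearMap.ker (F₀.coprod (-G)).toLinearMap := by
    rintro ⟨s, w⟩ hz
    have hs0 : s = 0 := hker _ hz
    subst hs0
    simpa using hz
  -- Equal dimensions turn the inclusion of kernels into an equality, but `(1, 0)` lies only in the
  -- kernel over `0`.
  have heq := Submodule.eq_of_le_of_finrank_eq hle (e₁.symm.trans e₀)
  have hmem : ((1 : ℝ), (0 : E.E)) ∈ LinearMap.ker (F₀.coprod (-G)).toLinearMap := by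
    simp [hF₀]
  rw [← heq] at hmem
  exact one_ne_zero (hker _ hmem)

theorem isUsualSubmersion_of_isSubmersion (hq : IsSubmersion p q) : IsUsualSubmersion q := by
  intro a w
  -- The pair `((q a, w), a)` is a compatible pair of points; a point of `TE` over it is a preimage
  -- of `w` at `a`.
  obtain ⟨⟨b, u⟩, h₁, h₂⟩ := exists_of_isWeakPullback hq.1
    (n := (⟨toMap q a, w⟩ : TangentBundle M.I M)) (x := a) rfl
  have hb : b = a := h₂
  subst hb
  exact ⟨u, eq_of_heq (Bundle.TotalSpace.mk.inj h₁).2⟩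

theorem isSubmersion_iff_isUsualSubmersion : IsSubmersion p q ↔ IsUsualSubmersion q :=
  ⟨isUsualSubmersion_of_isSubmersion, fun h => h.isSubmersion⟩

/-- Given `v`, surjectivity of `dq` supplies `w` with `dq w = df v`, and the compatible pair `(v,
w)` comes from a tangent vector of `P`. -/
theorem IsUsualSubmersion.of_isTPullback (hq : IsUsualSubmersion q) (h : IsTPullback T π₁ π₂ f q) :
    IsUsualSubmersion π₁ := by
  intro x v
  obtain ⟨w, hw⟩ := hq (toMap π₂ x) (mfderiv N.I M.I (toMap f) (toMap π₁ x) v : M.E)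
  obtain ⟨u, hu, -⟩ := exists_mfderiv_eq_of_isPullback h.1 (h.2 1 one_pos) x hw.symm
  exact ⟨u, hu⟩

end Converse

end Smooth

/-! ### The equivalences and maximality -/

theorem mainTheorem2 :
    (∀ {E M : Smooth} (q : E ⟶ M),
      List.TFAE [
        Smooth.IsUsualSubmersion q,
        TangentCat.IsSubmersion Smooth.p q,
        TangentCat.IsDisplaySubmersion Smooth.p q,
        TangentCat.IsTDisplayMap Smooth.T q]) ∧
    IsGreatest {D : MorphismProperty Smooth | TangentCat.IsTDisplaySystem Smooth.T D}
      (TangentCat.submersions Smooth.p) ∧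
    TangentCat.submersions Smooth.p = TangentCat.displaySubmersions Smooth.p := by
  refine ⟨fun {E M} q => ?_, ⟨⟨?_, ?_, ?_⟩, ?_⟩, ?_⟩
  · tfae_have 1 → 3 := fun h => ⟨h.isSubmersion, h.isTDisplayMap⟩
    tfae_have 3 → 4 := fun h => h.2
    tfae_have 4 → 1 := fun h => Smooth.isUsualSubmersion_of_admitsAllTPullbacks (h 0)
    tfae_have 1 ↔ 2 := Smooth.isSubmersion_iff_isUsualSubmersion.symm
    tfae_finish
  · intro P N E M π₁ π₂ f q hq h
    exact ((Smooth.isUsualSubmersion_of_isSubmersion hq).of_isTPullback h).isSubmersion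
  · intro E M q hq
    exact (Smooth.isUsualSubmersion_of_isSubmersion hq).admitsAllTPullbacks
  · intro E M q hq
    exact (Smooth.isUsualSubmersion_of_isSubmersion hq).map.isSubmersion
  -- Maximality: admitting all `T`-pullbacks already makes a member of `D` a submersion.
  · intro D hD E M q hq
    exact (Smooth.isUsualSubmersion_of_admitsAllTPullbacks (hD.admits q hq)).isSubmersion
  · ext E M q
    exact ⟨fun hq => ⟨hq, (Smooth.isUsualSubmersion_of_isSubmersion hq).isTDisplayMap⟩,
      fun hq => hq.1⟩
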